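/- **Lemma 5.1 (Any-time concentration of cost and arrival estimates).** Let $(\mathcal X,d)$ be a metric space with a $\sigma$-algebra, $\mathcal H$ a reproducing kernel Hilbert space of real functions on $\mathcal X$ with measurable kernel $\kappa$, and $c\in\mathcal H$ with $\|c\|_{\mathcal H}\le B$. Let $\lambda\ge 1$ and $R\ge 0$. Queries $x_1,x_2,\dots$ are i.i.d. with law $\nu$ on $\mathcal X$ (for instance $\nu=f\,dx$ on $\mathcal X\subset\mathbb R^{d_e}$). Let $(\mathcal F_t)_{t\ge0}$ be a filtration such that $x_t$ and the decision whether the LLM is invoked in round $t$ are $\mathcal F_{t-1}$-measurable; if it is invoked, $y_t=c(x_t)+\eta_t$ is observed, where $\eta_t$ is $\mathcal F_t$-measurable, $\mathbb E[\eta_t\mid\mathcal F_{t-1}]=0$ and $\mathbb E[e^{\xi\eta_t}\mid\mathcal F_{t-1}]\le e^{\xi^2R^2/2}$ a.s. for all $\xi\in\mathbb R$. For $t\ge 0$ let $z_1,\dots,z_\ell$ be the queries among $x_1,\dots,x_t$ for which the cost was observed, $y$ the vector of the observed costs, $K_t=[\kappa(z_i,z_j)]_{i,j}$, $\kappa_t(x)=[\kappa(z_i,x)]_i$,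 and $$\hat c_t(x)=\kappa_t(x)^\top(K_t+\lambda I)^{-1}y,\qquad \sigma_{t,\lambda}^2(x)=\kappa(x,x)-\kappa_t(x)^\top(K_t+\lambda I)^{-1}\kappa_t(x),\qquad \gamma_t=\tfrac12\log\det\!\big(I+\tfrac1\lambda K_t\big)$$ (so $\hat c_t=0$, $\sigma^2_{t,\lambda}(x)=\kappa(x,x)$, $\gamma_t=0$ if $\ell=0$). Let $S\subset\mathcal X$ be a finite (non-random) $\epsilon$-net, with at most $m_{\mathrm{eff}}$ points, of some region $A\subseteq\mathcal X$ (for instance $A=\mathcal X$, or a region of high $\nu$-probability; in particular $m_{\mathrm{eff}}$ may be the covering number of $A$ at radius $\epsilon$). Let $\{V_u\}_{u\in S}$ be its Voronoi cells: a measurable partition of $\mathcal X$ with $d(x,u)=\min_{v\in S}d(x,v)$ for $x\in V_u$, ties being broken arbitrarily. Put $w_u=\nu(V_u)$ and $\hat w_{t,u}=\frac1t\#\{s\le t: x_s\in V_u\}$. Let $\delta\in(0,1)$, $T\ge1$ and $\beta_t(x)=\big(B+R\sqrt{2(\gamma_t+\ln(2/\delta))}\big)\sigma_{t,\lambda}(x)$.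 Then there is an event of probability at least $1-\delta$ on which, for all $t\in\{1,\dots,T\}$ and all $x\in\mathcal X$, $$\|\hat{\boldsymbol w}_t-\boldsymbol w\|_1=\sum_{u\in S}|\hat w_{t,u}-w_u|\le\sqrt{\frac{2m_{\mathrm{eff}}\ln(2T^2/\delta)}{t}}\qquad\text{and}\qquad |\hat c_{t-1}(x)-c(x)|\le\beta_{t-1}(x),$$ and moreover the lower confidence bound satisfies $\hat c_t(x)-\beta_t(x)\le c(x)$ for all $t\in\{0,\dots,T\}$ and all $x\in\mathcal X$. -/

import Mathlib

open MeasureTheory ProbabilityTheory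
open scoped NNReal Matrix

noncomputable section

/-! ### Kernel ridge regression -/

/-- The real-valued kernel `κ(x, y)` of a reproducing kernel Hilbert space `H` of real functions
on `𝒳` (Mathlib's `RKHS.kernel H x y` is the operator `v ↦ κ(x, y) v` on `ℝ`). -/
def scalarKernel {𝒳 : Type*} (H : Type*) [NormedAddCommGroup H] [InnerProductSpace ℝ H]
    [CompleteSpace H] [RKHS ℝ H 𝒳 ℝ] (x y : 𝒳) : ℝ :=
  RKHS.kernel H x y 1

/-- The Gram matrix `K = [κ(zᵢ, zⱼ)]` of a finite family of inputs. -/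
def gram {𝒳 ι : Type*} (κ : 𝒳 → 𝒳 → ℝ) (z : ι → 𝒳) : Matrix ι ι ℝ :=
  Matrix.of fun i j => κ (z i) (z j)

/-- The KRR mean `κ_z(x)ᵀ (K + λ I)⁻¹ y` at `x`, from inputs `z` and responses `y`. -/
def krrMean {𝒳 ι : Type*} [Fintype ι] [DecidableEq ι] (κ : 𝒳 → 𝒳 → ℝ) (lam : ℝ)
    (z : ι → 𝒳) (y : ι → ℝ) (x : 𝒳) : ℝ :=
  (fun i => κ (z i) x) ⬝ᵥ ((gram κ z + lam • (1 : Matrix ι ι ℝ))⁻¹ *ᵥ y)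

/-- The KRR standard deviation: the square root of
`κ(x, x) - κ_z(x)ᵀ (K + λ I)⁻¹ κ_z(x)`. -/
def krrStd {𝒳 ι : Type*} [Fintype ι] [DecidableEq ι] (κ : 𝒳 → 𝒳 → ℝ) (lam : ℝ)
    (z : ι → 𝒳) (x : 𝒳) : ℝ :=
  Real.sqrt (κ x x - (fun i => κ (z i) x) ⬝ᵥ
    ((gram κ z + lam • (1 : Matrix ι ι ℝ))⁻¹ *ᵥ (fun i => κ (z i) x)))

/-- The information gain `(1/2) log det (I + λ⁻¹ K)`. -/
def infoGain {𝒳 ι : Type*} [Fintype ι] [DecidableEq ι] (κ : 𝒳 → 𝒳 → ℝ) (lam : ℝ)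
    (z : ι → 𝒳) : ℝ :=
  (1 / 2) * Real.log (Matrix.det ((1 : Matrix ι ι ℝ) + lam⁻¹ • gram κ z))

/-! ### The online protocol

Rounds are indexed by `s = 0, 1, 2, …`, index `s` standing for round `s + 1`; "the first `t` rounds"
are the indices `s < t`. In round `s` the query `x s` arrives, the LLM is invoked on the event `D s`,
and in that case the noisy cost `c (x s) + η s` is observed. -/

open Classical in
/-- The rounds among the first `t` in which the LLM was invoked, i.e. the cost was observed. -/
def observedRounds {Ω : Type*} (D : ℕ → Set Ω) (t : ℕ) (ω : Ω) : Finset ℕ :=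
  (Finset.range t).filter fun s => ω ∈ D s

/-- The inputs of the cost observations collected in the first `t` rounds. -/
def obsInput {Ω 𝒳 : Type*} (x : ℕ → Ω → 𝒳) (D : ℕ → Set Ω) (t : ℕ) (ω : Ω)
    (i : observedRounds D t ω) : 𝒳 :=
  x i ω

/-- The noisy costs observed in the first `t` rounds. -/
def obsCost {Ω 𝒳 : Type*} (c : 𝒳 → ℝ) (x : ℕ → Ω → 𝒳) (η : ℕ → Ω → ℝ) (D : ℕ → Set Ω)
    (t : ℕ) (ω : Ω) (i : observedRounds D t ω) : ℝ :=
  c (x i ω) + η i ω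

/-- The cost estimate `ĉ_t(q)`: the KRR mean of the data of the first `t` rounds. -/
def costEstimate {Ω 𝒳 : Type*} (κ : 𝒳 → 𝒳 → ℝ) (lam : ℝ) (c : 𝒳 → ℝ) (x : ℕ → Ω → 𝒳)
    (η : ℕ → Ω → ℝ) (D : ℕ → Set Ω) (t : ℕ) (ω : Ω) (q : 𝒳) : ℝ :=
  krrMean κ lam (obsInput x D t ω) (obsCost c x η D t ω) q

/-- The confidence radius `β_t(q) = (B + R √(2 (γ_t + ln(2/δ)))) σ_{t,λ}(q)`. -/
def confRadius {Ω 𝒳 : Type*} (κ : 𝒳 → 𝒳 → ℝ) (lam B R δ : ℝ) (x : ℕ → Ω → 𝒳)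
    (D : ℕ → Set Ω) (t : ℕ) (ω : Ω) (q : 𝒳) : ℝ :=
  (B + R * Real.sqrt (2 * (infoGain κ lam (obsInput x D t ω) + Real.log (2 / δ)))) *
    krrStd κ lam (obsInput x D t ω) q

/-- The lower confidence bound `ĉ_t(q) - β_t(q)`. -/
def costLCB {Ω 𝒳 : Type*} (κ : 𝒳 → 𝒳 → ℝ) (lam B R δ : ℝ) (c : 𝒳 → ℝ) (x : ℕ → Ω → 𝒳)
    (η : ℕ → Ω → ℝ) (D : ℕ → Set Ω) (t : ℕ) (ω : Ω) (q : 𝒳) : ℝ :=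
  costEstimate κ lam c x η D t ω q - confRadius κ lam B R δ x D t ω q

/-- The noise sequence is conditionally centred and `R`-sub-Gaussian, `ℱ s` being the history
before the noise of round `s` is revealed. (Mathlib's conditional expectation of a
non-integrable function is `0`, so integrability is part of the definition.) -/
def IsCondSubGaussian {Ω : Type*} {mΩ : MeasurableSpace Ω} (μ : Measure Ω) (ℱ : Filtration ℕ mΩ)
    (η : ℕ → Ω → ℝ) (R : ℝ) : Prop :=
  ∀ s, Integrable (η s) μ ∧ μ[η s | ℱ s] =ᵐ[μ] 0 ∧
    ∀ ξ : ℝ, Integrable (fun ω => Real.exp (ξ * η s ω)) μ ∧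
      μ[fun ω => Real.exp (ξ * η s ω) | ℱ s] ≤ᵐ[μ] fun _ => Real.exp (ξ ^ 2 * R ^ 2 / 2)

/-! ### Voronoi cells and arrival weights -/

/-- `V` is a measurable nearest-centre assignment for the finite set `S` of centres. Its fibres
`V ⁻¹' {u}`, `u ∈ S`, are the Voronoi cells of `S`, points equidistant from several nearest
centres being given to one of them, so that the cells partition the space. -/
structure IsVoronoiAssignment {𝒳 : Type*} [MetricSpace 𝒳] [MeasurableSpace 𝒳]
    (S : Finset 𝒳) (V : 𝒳 → 𝒳) : Prop where
  mem : ∀ q, V q ∈ S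
  nearest : ∀ q, ∀ u ∈ S, dist q (V q) ≤ dist q u
  measurableSet_cell : ∀ u ∈ S, MeasurableSet (V ⁻¹' {u})

/-- The true weight of the cell of `u` under the arrival law `ν`. -/
def cellWeight {𝒳 : Type*} [MeasurableSpace 𝒳] (ν : Measure 𝒳) (V : 𝒳 → 𝒳) (u : 𝒳) : ℝ :=
  ν.real (V ⁻¹' {u})

open Classical in
/-- The empirical weight of the cell of `u`: the fraction of the first `t` queries in it. -/
def empWeight {Ω 𝒳 : Type*} (V : 𝒳 → 𝒳) (x : ℕ → Ω → 𝒳) (t : ℕ) (ω : Ω) (u : 𝒳) : ℝ :=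
  (((Finset.range t).filter fun s => V (x s ω) = u).card : ℝ) / t

end

/-! Two bad events of probability at most `δ / 2` each are discarded, one for the costs and one for
the weights.

Costs. In terms of the feature map `φ` of the kernel, the estimation error at `q` splits into ridge
regression applied to `c` itself and ridge regression applied to the noise. The first part pairs `c`
with the ridge residual of `φ q`, so it is at most `‖c‖ σ(q)`. The second is at most `√Q σ(q)`,
where `Q = eᵀ K (K + λ I)⁻¹ e` is the energy of the noise vector `e` (`krrMean_sq_le`). Since `Q`
does not involve `q`, uniformity in `q` is free, and it remains to show `Q ≤ 2 R² (γ + log (2 / δ))`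
for all rounds at once.

For this, `exp (Q / (2 R²) - γ)` is a nonnegative supermartingale started at 1. A new observation
changes `Q` and `γ` in closed form through the ridge prediction `m` of the new noise and the scaled
variance `v` (`logMixture_insert`). The resulting factor is the average of the tilts `exp (ξ η - ξ²
R² / 2)` over a Gaussian `ξ` with mean `m / R²` and variance `v / R²`, both known before `η`, so it
does not increase the expectation (`lintegral_mul_mixture_le`). Ville's inequality
`mul_measure_exists_lt_le` concludes. Mixing one real parameter per step replaces a Gaussian mixture
over the whole function space.

Weights. The deviations of the cell weights sum to zero, so half their `ℓ¹` norm is the deviation of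
a single union of cells. Hoeffding's inequality bounds each of the `2 ^ |S| - 2` nontrivial unions,
and a union bound covers these and the `T` rounds. -/

/-! ### Deterministic ridge regression: error bounds and rank-one updates. -/

section Ridge

variable {𝒳 E ι : Type*} [NormedAddCommGroup E] [InnerProductSpace ℝ E] {κ : 𝒳 → 𝒳 → ℝ}
  {φ : 𝒳 → E} {lam : ℝ}

/-- The regularised energy `eᵀ K (K + λ I)⁻¹ e = eᵀ e - λ eᵀ (K + λ I)⁻¹ e` of a vector `e`. -/
noncomputable def ridgeEnergy {𝒳 ι : Type*} [Fintype ι] [DecidableEq ι] (κ : 𝒳 → 𝒳 → ℝ) (lam : ℝ)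
    (z : ι → 𝒳) (e : ι → ℝ) : ℝ :=
  e ⬝ᵥ e - lam * (e ⬝ᵥ ((gram κ z + lam • (1 : Matrix ι ι ℝ))⁻¹ *ᵥ e))

/-- The ridge variance `κ(x, x) - κ_z(x)ᵀ (K + λ I)⁻¹ κ_z(x)`. -/
noncomputable def ridgeVar {𝒳 ι : Type*} [Fintype ι] [DecidableEq ι] (κ : 𝒳 → 𝒳 → ℝ) (lam : ℝ)
    (z : ι → 𝒳) (x : 𝒳) : ℝ :=
  κ x x - (fun i => κ (z i) x) ⬝ᵥ
    ((gram κ z + lam • (1 : Matrix ι ι ℝ))⁻¹ *ᵥ (fun i => κ (z i) x))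

theorem isSymm_gram (hκ : ∀ x y, κ x y = inner ℝ (φ x) (φ y)) (z : ι → 𝒳) :
    (gram κ z)ᵀ = gram κ z := by
  ext i j
  simp [gram, hκ, real_inner_comm]

variable [Fintype ι]

theorem dotProduct_gram_mulVec (hκ : ∀ x y, κ x y = inner ℝ (φ x) (φ y)) (z : ι → 𝒳)
    (v : ι → ℝ) : v ⬝ᵥ (gram κ z *ᵥ v) = ‖∑ i, v i • φ (z i)‖ ^ 2 := by
  rw [← real_inner_self_eq_norm_sq, sum_inner]
  simp only [dotProduct, Matrix.mulVec, gram, Matrix.of_apply, inner_sum, real_inner_smul_left,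
    real_inner_smul_right, Finset.mul_sum, hκ]
  exact Finset.sum_congr rfl fun i _ => Finset.sum_congr rfl fun j _ => by ring

theorem gram_option (hκ : ∀ x y, κ x y = inner ℝ (φ x) (φ y)) (z : Option ι → 𝒳)
    (v : Option ι → ℝ) :
    (∀ i : ι, (gram κ z *ᵥ v) (some i) =
      (gram κ (fun i => z (some i)) *ᵥ fun i => v (some i)) i +
        κ (z (some i)) (z none) * v none) ∧
    (gram κ z *ᵥ v) none = κ (z none) (z none) * v none +
      (fun i => κ (z (some i)) (z none)) ⬝ᵥ fun i => v (some i) := by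
  constructor
  · intro i
    simp [Matrix.mulVec, dotProduct, gram, Fintype.sum_option, add_comm]
  · simp only [Matrix.mulVec, dotProduct, gram, Fintype.sum_option, Matrix.of_apply]
    congr 1
    exact Finset.sum_congr rfl fun i _ => by rw [hκ, hκ, real_inner_comm]

variable [DecidableEq ι]

theorem posDef_gram_add_smul_one (hκ : ∀ x y, κ x y = inner ℝ (φ x) (φ y)) (hlam : 0 < lam)
    (z : ι → 𝒳) : (gram κ z + lam • (1 : Matrix ι ι ℝ)).PosDef := by
  refine Matrix.PosDef.posSemidef_add (Matrix.PosSemidef.of_dotProduct_mulVec_nonneg ?_ ?_) ?_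
  · rw [Matrix.IsHermitian, Matrix.conjTranspose_eq_transpose_of_trivial, isSymm_gram hκ]
  · intro v
    simp only [star_trivial, dotProduct_gram_mulVec hκ]
    positivity
  · exact Matrix.PosDef.one.smul hlam

/-- `(K + λ I)⁻¹ e` is the unique solution `α` of `K α + λ α = e`. -/
theorem inv_mulVec_eq_iff (hκ : ∀ x y, κ x y = inner ℝ (φ x) (φ y)) (hlam : 0 < lam)
    (z : ι → 𝒳) (e α : ι → ℝ) :
    (gram κ z + lam • (1 : Matrix ι ι ℝ))⁻¹ *ᵥ e = α ↔ gram κ z *ᵥ α + lam • α = e := by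
  have hu := (Matrix.isUnit_iff_isUnit_det _).1 (posDef_gram_add_smul_one hκ hlam z).isUnit
  have h : (gram κ z + lam • (1 : Matrix ι ι ℝ)) *ᵥ α = gram κ z *ᵥ α + lam • α := by
    rw [Matrix.add_mulVec, Matrix.smul_mulVec, Matrix.one_mulVec]
  rw [← h]
  constructor
  · rintro rfl
    rw [Matrix.mulVec_mulVec, Matrix.mul_nonsing_inv _ hu, Matrix.one_mulVec]
  · rintro rfl
    rw [Matrix.mulVec_mulVec, Matrix.nonsing_inv_mul _ hu, Matrix.one_mulVec]

theorem dotProduct_inv_mulVec_comm (hκ : ∀ x y, κ x y = inner ℝ (φ x) (φ y)) (z : ι → 𝒳)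
    (e f : ι → ℝ) :
    e ⬝ᵥ ((gram κ z + lam • (1 : Matrix ι ι ℝ))⁻¹ *ᵥ f) =
      f ⬝ᵥ ((gram κ z + lam • (1 : Matrix ι ι ℝ))⁻¹ *ᵥ e) := by
  rw [Matrix.dotProduct_mulVec, ← Matrix.mulVec_transpose, Matrix.transpose_nonsing_inv,
    Matrix.transpose_add, isSymm_gram hκ, Matrix.transpose_smul, Matrix.transpose_one,
    dotProduct_comm]

/-- With `e = K α + λ α` the energy becomes `‖K α‖² + λ αᵀ K α`, and `K` is positive semidefinite.
-/
theorem ridgeEnergy_nonneg (hκ : ∀ x y, κ x y = inner ℝ (φ x) (φ y)) (hlam : 0 < lam)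
    (z : ι → 𝒳) (e : ι → ℝ) : 0 ≤ ridgeEnergy κ lam z e := by
  obtain ⟨α, hα⟩ : ∃ α, (gram κ z + lam • (1 : Matrix ι ι ℝ))⁻¹ *ᵥ e = α := ⟨_, rfl⟩
  have he := (inv_mulVec_eq_iff hκ hlam z e α).1 hα
  have key : ridgeEnergy κ lam z e =
      (gram κ z *ᵥ α) ⬝ᵥ (gram κ z *ᵥ α) + lam * (α ⬝ᵥ (gram κ z *ᵥ α)) := by
    rw [ridgeEnergy, hα, ← he]
    simp only [add_dotProduct, dotProduct_add, smul_dotProduct, dotProduct_smul, smul_eq_mul]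
    rw [dotProduct_comm _ α]
    ring
  rw [key, dotProduct_gram_mulVec hκ]
  have : 0 ≤ (gram κ z *ᵥ α) ⬝ᵥ (gram κ z *ᵥ α) :=
    Finset.sum_nonneg fun i _ => mul_self_nonneg _
  positivity

/-- The residual of the kernel section at `x` after ridge projection is bounded by the variance. -/
theorem norm_sq_residual_le (hκ : ∀ x y, κ x y = inner ℝ (φ x) (φ y)) (hlam : 0 < lam)
    (z : ι → 𝒳) (x : 𝒳) :
    ‖φ x - ∑ i, ((gram κ z + lam • (1 : Matrix ι ι ℝ))⁻¹ *ᵥ (fun i => κ (z i) x)) i • φ (z i)‖ ^ 2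
      ≤ ridgeVar κ lam z x := by
  obtain ⟨β, hβ⟩ : ∃ β, (gram κ z + lam • (1 : Matrix ι ι ℝ))⁻¹ *ᵥ (fun i => κ (z i) x) = β :=
    ⟨_, rfl⟩
  have he := (inv_mulVec_eq_iff hκ hlam z _ β).1 hβ
  have h1 : inner ℝ (φ x) (∑ i, β i • φ (z i)) = (fun i => κ (z i) x) ⬝ᵥ β := by
    simp only [inner_sum, real_inner_smul_right, dotProduct, hκ]
    exact Finset.sum_congr rfl fun i _ => by rw [real_inner_comm, mul_comm]
  -- The normal equations `K β + λ β = k` turn `βᵀ K β` into `kᵀ β - λ βᵀ β`; the squared residual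
  -- is then exactly the ridge variance minus `λ βᵀ β`.
  have h2 : ‖∑ i, β i • φ (z i)‖ ^ 2 = (fun i => κ (z i) x) ⬝ᵥ β - lam * (β ⬝ᵥ β) := by
    rw [← dotProduct_gram_mulVec hκ, eq_sub_iff_add_eq, ← smul_eq_mul, ← dotProduct_smul,
      ← dotProduct_add, he, dotProduct_comm]
  have h3 : 0 ≤ lam * (β ⬝ᵥ β) :=
    mul_nonneg hlam.le (Finset.sum_nonneg fun i _ => mul_self_nonneg _)
  rw [ridgeVar, hβ, norm_sub_sq_real, h1, h2, hκ x x, real_inner_self_eq_norm_sq]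
  linarith

theorem ridgeVar_nonneg (hκ : ∀ x y, κ x y = inner ℝ (φ x) (φ y)) (hlam : 0 < lam)
    (z : ι → 𝒳) (x : 𝒳) : 0 ≤ ridgeVar κ lam z x :=
  (sq_nonneg _).trans (norm_sq_residual_le hκ hlam z x)

/-- Noiseless ridge regression has error at most `‖f‖ σ(x)`. -/
theorem abs_krrMean_sub_le (hκ : ∀ x y, κ x y = inner ℝ (φ x) (φ y)) (hlam : 0 < lam)
    (z : ι → 𝒳) (f : E) (x : 𝒳) :
    |krrMean κ lam z (fun i => inner ℝ f (φ (z i))) x - inner ℝ f (φ x)| ≤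
      ‖f‖ * krrStd κ lam z x := by
  have h : krrMean κ lam z (fun i => inner ℝ f (φ (z i))) x - inner ℝ f (φ x) =
      -inner ℝ f (φ x - ∑ i, ((gram κ z + lam • (1 : Matrix ι ι ℝ))⁻¹ *ᵥ
        (fun i => κ (z i) x)) i • φ (z i)) := by
    rw [krrMean, dotProduct_inv_mulVec_comm hκ, inner_sub_right, neg_sub, inner_sum]
    simp only [real_inner_smul_right, dotProduct]
    simp only [mul_comm]
  rw [h, abs_neg]
  refine (abs_real_inner_le_norm _ _).trans ?_
  gcongr
  exact Real.le_sqrt_of_sq_le (norm_sq_residual_le hκ hlam z x)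

theorem krrMean_add (z : ι → 𝒳) (y e : ι → ℝ) (x : 𝒳) :
    krrMean κ lam z (fun i => y i + e i) x = krrMean κ lam z y x + krrMean κ lam z e x := by
  rw [krrMean, krrMean, krrMean, ← dotProduct_add, ← Matrix.mulVec_add]
  rfl

/-! #### Adding one observation -/

/-- Block inversion. The increment equals `e² - (e - m)² / (1 + v)` with `e` the new entry: its
square, less the squared innovation normalised by the Schur complement `λ (1 + v)`. -/
theorem ridgeEnergy_option (hκ : ∀ x y, κ x y = inner ℝ (φ x) (φ y)) (hlam : 0 < lam)
    (z : Option ι → 𝒳) (e : Option ι → ℝ) {v m : ℝ}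
    (hv : v = ridgeVar κ lam (fun i => z (some i)) (z none) / lam)
    (hm : m = krrMean κ lam (fun i => z (some i)) (fun i => e (some i)) (z none)) :
    ridgeEnergy κ lam z e = ridgeEnergy κ lam (fun i => z (some i)) (fun i => e (some i)) +
      (v * e none ^ 2 + 2 * m * e none - m ^ 2) / (1 + v) := by
  set z' : ι → 𝒳 := fun i => z (some i) with hz'
  set e' : ι → ℝ := fun i => e (some i) with he'
  set k : ι → ℝ := fun i => κ (z' i) (z none) with hk
  obtain ⟨α, hα⟩ : ∃ α, (gram κ z' + lam • (1 : Matrix ι ι ℝ))⁻¹ *ᵥ e' = α := ⟨_, rfl⟩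
  obtain ⟨β, hβ⟩ : ∃ β, (gram κ z' + lam • (1 : Matrix ι ι ℝ))⁻¹ *ᵥ k = β := ⟨_, rfl⟩
  have hα' := (inv_mulVec_eq_iff hκ hlam z' _ α).1 hα
  have hβ' := (inv_mulVec_eq_iff hκ hlam z' _ β).1 hβ
  have hm1 : k ⬝ᵥ α = m := by rw [hm, krrMean, hα]
  have hm2 : e' ⬝ᵥ β = m := by rw [← hm1, ← hβ, dotProduct_inv_mulVec_comm hκ, hα]
  have hv1 : k ⬝ᵥ β = κ (z none) (z none) - lam * v := by
    rw [hv, ridgeVar, hβ]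
    field_simp
    ring
  have hv0 : 0 ≤ v := hv ▸ div_nonneg (ridgeVar_nonneg hκ hlam _ _) hlam.le
  -- `τ` is the new coordinate of the solution, innovation over Schur complement; the old
  -- coordinates move from `α` to `α - τ β`.
  obtain ⟨τ, hτ⟩ : ∃ τ, τ * (lam * (1 + v)) = e none - m :=
    ⟨(e none - m) / (lam * (1 + v)), by field_simp⟩
  have hsol : (gram κ z + lam • (1 : Matrix (Option ι) (Option ι) ℝ))⁻¹ *ᵥ e =
      fun o => o.elim τ (fun i => α i - τ * β i) := by
    rw [inv_mulVec_eq_iff hκ hlam]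
    obtain ⟨g1, g2⟩ := gram_option hκ z (fun o => o.elim τ (fun i => α i - τ * β i))
    funext o
    cases o with
    | none =>
      rw [Pi.add_apply, g2]
      change κ (z none) (z none) * τ + k ⬝ᵥ (α - τ • β) + lam * τ = e none
      rw [dotProduct_sub, dotProduct_smul, smul_eq_mul, hm1, hv1]
      linear_combination hτ
    | some i =>
      rw [Pi.add_apply, g1]
      change (gram κ z' *ᵥ (α - τ • β)) i + κ (z (some i)) (z none) * τ +
        lam * (α i - τ * β i) = e (some i)
      rw [Matrix.mulVec_sub, Matrix.mulVec_smul]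
      have a1 := congrFun hα' i
      have a2 := congrFun hβ' i
      simp only [Pi.add_apply, Pi.smul_apply, smul_eq_mul, Pi.sub_apply, hk, he', hz'] at a1 a2 ⊢
      linear_combination a1 - τ * a2
  have hlin : (fun i => α i - τ * β i) = α - τ • β := rfl
  have hq : e ⬝ᵥ (fun o : Option ι => o.elim τ (fun i => α i - τ * β i)) =
      e none * τ + e' ⬝ᵥ α - τ * m := by
    rw [← hm2]
    have : e ⬝ᵥ (fun o : Option ι => o.elim τ (fun i => α i - τ * β i)) =
      e none * τ + e' ⬝ᵥ (fun i => α i - τ * β i) := by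
        simp [dotProduct, Fintype.sum_option, he']
    rw [this, hlin, dotProduct_sub, dotProduct_smul, smul_eq_mul]
    ring
  have hee : e ⬝ᵥ e = e none ^ 2 + e' ⬝ᵥ e' := by
    simp [dotProduct, Fintype.sum_option, he', sq]
  rw [ridgeEnergy, ridgeEnergy, hsol, hq, hα, hee]
  have hτ' : lam * τ = (e none - m) / (1 + v) := by
    rw [eq_div_iff (by positivity)]
    linear_combination hτ
  have : lam * (e none * τ + e' ⬝ᵥ α - τ * m) = lam * (e' ⬝ᵥ α) + (e none - m) * (lam * τ) := by
    ring
  rw [this, hτ']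
  field_simp
  ring

/-- The Schur complement of the old block of `K + λ I` is the scalar `ridgeVar + λ`; dividing by `λ`
gives the new factor. -/
theorem det_option (hκ : ∀ x y, κ x y = inner ℝ (φ x) (φ y)) (hlam : 0 < lam)
    (z : Option ι → 𝒳) :
    ((1 : Matrix (Option ι) (Option ι) ℝ) + lam⁻¹ • gram κ z).det =
      ((1 : Matrix ι ι ℝ) + lam⁻¹ • gram κ (fun i => z (some i))).det *
        (1 + ridgeVar κ lam (fun i => z (some i)) (z none) / lam) := by
  set z' : ι → 𝒳 := fun i => z (some i) with hz'
  set k : ι → ℝ := fun i => κ (z' i) (z none) with hk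
  have hPD := posDef_gram_add_smul_one hκ hlam z'
  have hA : (1 : Matrix ι ι ℝ) + lam⁻¹ • gram κ z' =
      lam⁻¹ • (gram κ z' + lam • (1 : Matrix ι ι ℝ)) := by
    rw [smul_add, smul_smul, inv_mul_cancel₀ hlam.ne', one_smul, add_comm]
  have hA' : (1 : Matrix (Option ι) (Option ι) ℝ) + lam⁻¹ • gram κ z =
      lam⁻¹ • (gram κ z + lam • (1 : Matrix (Option ι) (Option ι) ℝ)) := by
    rw [smul_add, smul_smul, inv_mul_cancel₀ hlam.ne', one_smul, add_comm]
  have hblock : (gram κ z + lam • (1 : Matrix (Option ι) (Option ι) ℝ)).submatrix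
      (Equiv.optionEquivSumPUnit.{0} ι).symm (Equiv.optionEquivSumPUnit.{0} ι).symm =
      Matrix.fromBlocks (gram κ z' + lam • (1 : Matrix ι ι ℝ))
        (Matrix.of fun i (_ : PUnit.{1}) => k i) (Matrix.of fun (_ : PUnit.{1}) i => k i)
        (Matrix.of fun _ _ => κ (z none) (z none) + lam) := by
    ext i j
    rcases i with i | i <;> rcases j with j | j <;>
      simp [gram, Matrix.one_apply, hk, hz', hκ, real_inner_comm]
  let _ := hPD.isUnit.invertible
  have hdet : (gram κ z + lam • (1 : Matrix (Option ι) (Option ι) ℝ)).det =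
      (gram κ z' + lam • (1 : Matrix ι ι ℝ)).det * (ridgeVar κ lam z' (z none) + lam) := by
    rw [← Matrix.det_submatrix_equiv_self (Equiv.optionEquivSumPUnit.{0} ι).symm, hblock,
      Matrix.det_fromBlocks₁₁]
    congr 1
    rw [Matrix.det_unique]
    simp only [ridgeVar, Matrix.sub_apply, Matrix.of_apply, Matrix.invOf_eq_nonsing_inv]
    rw [dotProduct_inv_mulVec_comm hκ, Matrix.mul_assoc, Matrix.mul_apply]
    simp only [dotProduct, Matrix.of_apply, Matrix.mul_apply, Matrix.mulVec, hk]
    ring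
  rw [hA, hA', Matrix.det_smul, Matrix.det_smul, hdet, Fintype.card_option, pow_succ]
  field_simp
  ring

theorem det_one_add_gram_pos (hκ : ∀ x y, κ x y = inner ℝ (φ x) (φ y)) (hlam : 0 < lam) (z : ι → 𝒳) :
    0 < ((1 : Matrix ι ι ℝ) + lam⁻¹ • gram κ z).det := by
  have : (1 : Matrix ι ι ℝ) + lam⁻¹ • gram κ z =
      lam⁻¹ • (gram κ z + lam • (1 : Matrix ι ι ℝ)) := by
    rw [smul_add, smul_smul, inv_mul_cancel₀ hlam.ne', one_smul, add_comm]
  rw [this]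
  exact ((posDef_gram_add_smul_one hκ hlam z).smul (inv_pos.2 hlam)).det_pos

theorem infoGain_option (hκ : ∀ x y, κ x y = inner ℝ (φ x) (φ y)) (hlam : 0 < lam)
    (z : Option ι → 𝒳) :
    infoGain κ lam z = infoGain κ lam (fun i => z (some i)) +
      (1 / 2) * Real.log (1 + ridgeVar κ lam (fun i => z (some i)) (z none) / lam) := by
  have := ridgeVar_nonneg hκ hlam (fun i => z (some i)) (z none)
  rw [infoGain, infoGain, det_option hκ hlam, Real.log_mul (det_one_add_gram_pos hκ hlam _).ne'
    (by positivity)]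
  ring

/-- Ridge regression on pure noise: the squared mean is at most variance times energy. -/
theorem krrMean_sq_le (hκ : ∀ x y, κ x y = inner ℝ (φ x) (φ y)) (hlam : 0 < lam)
    (z : ι → 𝒳) (e : ι → ℝ) (x : 𝒳) :
    krrMean κ lam z e x ^ 2 ≤ ridgeVar κ lam z x / lam * ridgeEnergy κ lam z e := by
  obtain ⟨v, hv⟩ : ∃ v, v = ridgeVar κ lam z x / lam := ⟨_, rfl⟩
  obtain ⟨m, hm⟩ : ∃ m, m = krrMean κ lam z e x := ⟨_, rfl⟩
  have hv0 : 0 ≤ v := hv ▸ div_nonneg (ridgeVar_nonneg hκ hlam _ _) hlam.le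
  -- Append a fictitious observation at `x` with arbitrary value `η`. The enlarged energy is
  -- nonnegative and quadratic in `η`, so its discriminant is nonpositive, which is the claim
  -- multiplied by `1 + v`.
  have h : ∀ η : ℝ, 0 ≤ v * (η * η) + 2 * m * η +
      (ridgeEnergy κ lam z e * (1 + v) - m ^ 2) := by
    intro η
    have h1 := ridgeEnergy_nonneg hκ hlam (fun o : Option ι => o.elim x z)
      (fun o => o.elim η e)
    rw [ridgeEnergy_option hκ hlam (fun o : Option ι => o.elim x z)
      (fun o => o.elim η e) hv hm] at h1
    have h2 := mul_nonneg h1 (show 0 ≤ 1 + v by positivity)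
    rw [add_mul, div_mul_cancel₀ _ (by positivity)] at h2
    simp only [Option.elim] at h2
    linarith
  have h3 := discrim_le_zero h
  rw [discrim] at h3
  rw [← hv, ← hm]
  have h4 : (1 + v) * (m ^ 2) ≤ (1 + v) * (v * ridgeEnergy κ lam z e) := by linarith
  exact le_of_mul_le_mul_left h4 (by positivity)

/-- Deterministic error bound of kernel ridge regression in terms of the noise energy. -/
theorem abs_krrMean_noisy_sub_le (hκ : ∀ x y, κ x y = inner ℝ (φ x) (φ y)) (hlam : 1 ≤ lam)
    (z : ι → 𝒳) (f : E) (e : ι → ℝ) (x : 𝒳) :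
    |krrMean κ lam z (fun i => inner ℝ f (φ (z i)) + e i) x - inner ℝ f (φ x)| ≤
      (‖f‖ + Real.sqrt (ridgeEnergy κ lam z e)) * krrStd κ lam z x := by
  have hlam0 : 0 < lam := by linarith
  have h1 := abs_krrMean_sub_le hκ hlam0 z f x
  have hq := ridgeEnergy_nonneg hκ hlam0 z e
  have hv := ridgeVar_nonneg hκ hlam0 z x
  have h2 : |krrMean κ lam z e x| ≤ Real.sqrt (ridgeEnergy κ lam z e) * krrStd κ lam z x := by
    rw [krrStd, ← Real.sqrt_mul hq]
    refine Real.abs_le_sqrt ((krrMean_sq_le hκ hlam0 z e x).trans ?_)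
    rw [mul_comm]
    -- Here `1 ≤ lam` is needed rather than mere positivity: it absorbs the factor `1 / λ`.
    exact mul_le_mul_of_nonneg_left (div_le_self hv hlam) hq
  rw [krrMean_add, add_sub_right_comm, add_mul]
  exact (abs_add_le _ _).trans (add_le_add h1 h2)

/-! #### Reindexing -/

variable {ι' : Type*} [Fintype ι'] [DecidableEq ι']

/-- Reindexing transfers the `Option` updates to data indexed by `insert t F`. -/
theorem inv_gram_comp_equiv (z : ι → 𝒳) (σ : ι' ≃ ι) :
    (gram κ (z ∘ σ) + lam • (1 : Matrix ι' ι' ℝ))⁻¹ =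
      (gram κ z + lam • (1 : Matrix ι ι ℝ))⁻¹.submatrix σ σ := by
  rw [← Matrix.inv_submatrix_equiv]
  congr 1
  ext i j
  simp [gram, Matrix.one_apply]

theorem ridgeEnergy_comp_equiv (z : ι → 𝒳) (e : ι → ℝ) (σ : ι' ≃ ι) :
    ridgeEnergy κ lam (z ∘ σ) (e ∘ σ) = ridgeEnergy κ lam z e := by
  rw [ridgeEnergy, ridgeEnergy, inv_gram_comp_equiv, Matrix.submatrix_mulVec_equiv,
    comp_equiv_dotProduct_comp_equiv, comp_equiv_dotProduct_comp_equiv, Function.comp_assoc,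
    Equiv.self_comp_symm, Function.comp_id]

theorem infoGain_comp_equiv (z : ι → 𝒳) (σ : ι' ≃ ι) :
    infoGain κ lam (z ∘ σ) = infoGain κ lam z := by
  rw [infoGain, infoGain, ← Matrix.det_submatrix_equiv_self σ]
  congr 4
  ext i j
  simp [Matrix.one_apply]

end Ridge

/-! ### Exponential tilts, their Gaussian mixtures, and Ville's inequality. -/

section Tilt

variable {Ω : Type*} {m mΩ : MeasurableSpace Ω} {μ : Measure Ω}

/-- A density whose integral over every `m`-measurable set is at most the measure of that set
does not increase integrals of `m`-measurable functions. -/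
theorem lintegral_mul_le_of_setLIntegral_le (hm : m ≤ mΩ) {f W : Ω → ENNReal}
    (hf : Measurable[mΩ] f) (hW : Measurable[m] W)
    (h : ∀ A, MeasurableSet[m] A → ∫⁻ ω in A, f ω ∂μ ≤ μ A) :
    ∫⁻ ω, W ω * f ω ∂μ ≤ ∫⁻ ω, W ω ∂μ := by
  -- The hypothesis compares the two measures on `m` only, but an `m`-measurable integrand sees no
  -- more than their traces there.
  have hle : (μ.withDensity f).trim hm ≤ μ.trim hm := by
    refine Measure.le_iff.2 fun A hA => ?_
    rw [trim_measurableSet_eq hm hA, trim_measurableSet_eq hm hA, withDensity_apply _ (hm _ hA)]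
    exact h A hA
  calc ∫⁻ ω, W ω * f ω ∂μ = ∫⁻ ω, W ω ∂(μ.withDensity f) := by
        rw [lintegral_withDensity_eq_lintegral_mul _ hf (hW.mono hm le_rfl)]
        simp only [Pi.mul_apply, mul_comm]
    _ = ∫⁻ ω, W ω ∂((μ.withDensity f).trim hm) := (lintegral_trim hm hW).symm
    _ ≤ ∫⁻ ω, W ω ∂(μ.trim hm) := lintegral_mono' hle le_rfl
    _ = ∫⁻ ω, W ω ∂μ := lintegral_trim hm hW

variable [IsProbabilityMeasure μ] {η : Ω → ℝ} {R : ℝ}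

theorem setLIntegral_exp_le (hm : m ≤ mΩ) {ξ : ℝ}
    (hint : Integrable (fun ω => Real.exp (ξ * η ω)) μ)
    (hle : μ[fun ω => Real.exp (ξ * η ω) | m] ≤ᵐ[μ] fun _ => Real.exp (ξ ^ 2 * R ^ 2 / 2))
    {A : Set Ω} (hA : MeasurableSet[m] A) :
    ∫⁻ ω in A, ENNReal.ofReal (Real.exp (ξ * η ω - ξ ^ 2 * R ^ 2 / 2)) ∂μ ≤ μ A := by
  have h1 : ∫ ω in A, Real.exp (ξ * η ω) ∂μ ≤ μ.real A * Real.exp (ξ ^ 2 * R ^ 2 / 2) := by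
    rw [← setIntegral_condExp hm hint hA, ← smul_eq_mul, ← setIntegral_const]
    exact setIntegral_mono_ae integrable_condExp.integrableOn
      (integrable_const _).integrableOn hle
  have h2 : ∫ ω in A, Real.exp (ξ * η ω - ξ ^ 2 * R ^ 2 / 2) ∂μ ≤ μ.real A := by
    simp only [Real.exp_sub, integral_div]
    exact (div_le_iff₀ (Real.exp_pos _)).2 h1
  have h3 : Integrable (fun ω => Real.exp (ξ * η ω - ξ ^ 2 * R ^ 2 / 2)) μ := by
    simp only [Real.exp_sub]
    exact hint.div_const _
  rw [← ofReal_integral_eq_lintegral_ofReal h3.integrableOn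
    (Filter.Eventually.of_forall fun _ => (Real.exp_pos _).le)]
  exact ENNReal.ofReal_le_of_le_toReal h2

/-- The exponential supermartingale inequality with a random, `m`-measurable parameter `ξ`. -/
theorem lintegral_mul_exp_tilt_le (hm : m ≤ mΩ) (hη : Measurable[mΩ] η)
    (hsub : ∀ ξ : ℝ, Integrable (fun ω => Real.exp (ξ * η ω)) μ ∧
      μ[fun ω => Real.exp (ξ * η ω) | m] ≤ᵐ[μ] fun _ => Real.exp (ξ ^ 2 * R ^ 2 / 2))
    {ξ : Ω → ℝ} (hξ : Measurable[m] ξ) {W : Ω → ENNReal} (hW : Measurable[m] W) :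
    ∫⁻ ω, W ω * ENNReal.ofReal (Real.exp (ξ ω * η ω - ξ ω ^ 2 * R ^ 2 / 2)) ∂μ
      ≤ ∫⁻ ω, W ω ∂μ := by
  have hconst : ∀ (c : ℝ) (W : Ω → ENNReal), Measurable[m] W →
      ∫⁻ ω, W ω * ENNReal.ofReal (Real.exp (c * η ω - c ^ 2 * R ^ 2 / 2)) ∂μ
        ≤ ∫⁻ ω, W ω ∂μ := fun c W hW =>
    lintegral_mul_le_of_setLIntegral_le hm (by fun_prop) hW
      fun A hA => setLIntegral_exp_le hm (hsub c).1 (hsub c).2 hA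
  -- For a parameter with finitely many values, each level set is `m`-measurable and can be absorbed
  -- into the weight, leaving a constant tilt. Fatou's lemma then passes to general `ξ`.
  have hsimple : ∀ s : Ω → ℝ, Measurable[m] s → ∀ F : Finset ℝ, (∀ ω, s ω ∈ F) →
      ∫⁻ ω, W ω * ENNReal.ofReal (Real.exp (s ω * η ω - s ω ^ 2 * R ^ 2 / 2)) ∂μ
        ≤ ∫⁻ ω, W ω ∂μ := by
    intro s hs F hF
    have hmeas : ∀ c, Measurable[m] ((s ⁻¹' {c}).indicator W) := fun c =>
      hW.indicator (hs (measurableSet_singleton c))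
    have hsum : ∀ (G : ℝ → Ω → ENNReal) (ω : Ω), W ω * G (s ω) ω =
        ∑ c ∈ F, (s ⁻¹' {c}).indicator W ω * G c ω := by
      intro G ω
      rw [Finset.sum_eq_single (s ω)]
      · simp [Set.indicator]
      · intro c _ hc
        simp [Set.indicator, hc.symm]
      · intro h
        exact absurd (hF ω) h
    calc _ = ∫⁻ ω, ∑ c ∈ F, (s ⁻¹' {c}).indicator W ω *
          ENNReal.ofReal (Real.exp (c * η ω - c ^ 2 * R ^ 2 / 2)) ∂μ :=
          lintegral_congr fun ω => hsum (fun c ω =>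
            ENNReal.ofReal (Real.exp (c * η ω - c ^ 2 * R ^ 2 / 2))) ω
      _ = ∑ c ∈ F, ∫⁻ ω, (s ⁻¹' {c}).indicator W ω *
          ENNReal.ofReal (Real.exp (c * η ω - c ^ 2 * R ^ 2 / 2)) ∂μ :=
          lintegral_finsetSum _ fun c _ => ((hmeas c).mono hm le_rfl).mul (by fun_prop)
      _ ≤ ∑ c ∈ F, ∫⁻ ω, (s ⁻¹' {c}).indicator W ω ∂μ :=
          Finset.sum_le_sum fun c _ => hconst c _ (hmeas c)
      _ = ∫⁻ ω, ∑ c ∈ F, (s ⁻¹' {c}).indicator W ω ∂μ :=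
          (lintegral_finsetSum _ fun c _ => (hmeas c).mono hm le_rfl).symm
      _ = ∫⁻ ω, W ω ∂μ := lintegral_congr fun ω => by
          simpa using (hsum (fun _ _ => 1) ω).symm
  have happ : ∀ f : @SimpleFunc Ω m ℝ, Measurable[m] f ∧ ∃ F : Finset ℝ, ∀ ω, f ω ∈ F := fun f =>
    ⟨@SimpleFunc.measurable Ω ℝ m _ f, @SimpleFunc.range Ω ℝ m f, fun ω =>
      @SimpleFunc.mem_range_self Ω ℝ m f ω⟩
  have hsm : StronglyMeasurable[m] ξ := hξ.stronglyMeasurable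
  have hlim : ∀ ω, Filter.Tendsto (fun n => W ω * ENNReal.ofReal
      (Real.exp (hsm.approx n ω * η ω - hsm.approx n ω ^ 2 * R ^ 2 / 2))) Filter.atTop
      (nhds (W ω * ENNReal.ofReal (Real.exp (ξ ω * η ω - ξ ω ^ 2 * R ^ 2 / 2)))) := by
    intro ω
    refine ENNReal.Tendsto.const_mul (ENNReal.tendsto_ofReal ?_) (Or.inl ?_)
    · have hc : Continuous fun c : ℝ => Real.exp (c * η ω - c ^ 2 * R ^ 2 / 2) := by fun_prop
      exact (hc.tendsto (ξ ω)).comp (hsm.tendsto_approx ω)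
    -- `W` may be infinite, so the limit of the other factor must be nonzero.
    · exact (ENNReal.ofReal_pos.2 (Real.exp_pos _)).ne'
  have hmeas : ∀ n, Measurable[mΩ] fun ω => W ω * ENNReal.ofReal
      (Real.exp (hsm.approx n ω * η ω - hsm.approx n ω ^ 2 * R ^ 2 / 2)) := by
    intro n
    have h1 : Measurable[mΩ] W := hW.mono hm le_rfl
    have h2 : Measurable[mΩ] fun ω => hsm.approx n ω :=
      (happ (hsm.approx n)).1.mono hm le_rfl
    fun_prop
  calc _ = ∫⁻ ω, Filter.liminf (fun n => W ω * ENNReal.ofReal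
        (Real.exp (hsm.approx n ω * η ω - hsm.approx n ω ^ 2 * R ^ 2 / 2))) Filter.atTop ∂μ :=
        lintegral_congr fun ω => (hlim ω).liminf_eq.symm
    _ ≤ Filter.liminf (fun n => ∫⁻ ω, W ω * ENNReal.ofReal
        (Real.exp (hsm.approx n ω * η ω - hsm.approx n ω ^ 2 * R ^ 2 / 2)) ∂μ) Filter.atTop :=
        lintegral_liminf_le hmeas
    _ ≤ Filter.liminf (fun _ => ∫⁻ ω, W ω ∂μ) Filter.atTop :=
        Filter.liminf_le_liminf (Filter.Eventually.of_forall fun n =>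
          (happ (hsm.approx n)).2.elim fun F hF => hsimple _ (happ _).1 F hF)
    _ = ∫⁻ ω, W ω ∂μ := Filter.liminf_const _

/-- The Gaussian mixture of the exponential tilts, in closed form. -/
theorem lintegral_gaussian_mixture (a v y : ℝ) (hv : 0 ≤ v) :
    ∫⁻ g : ℝ, ENNReal.ofReal (Real.exp (-(1 / 2) * g ^ 2) / Real.sqrt (2 * Real.pi)) *
      ENNReal.ofReal (Real.exp ((a + Real.sqrt v * g) * y - (a + Real.sqrt v * g) ^ 2 / 2)) =
    ENNReal.ofReal (Real.exp ((v * y ^ 2 + 2 * a * y - a ^ 2) / (2 * (1 + v))) /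
      Real.sqrt (1 + v)) := by
  obtain ⟨r, hr, rfl⟩ : ∃ r, 0 ≤ r ∧ v = r ^ 2 :=
    ⟨Real.sqrt v, Real.sqrt_nonneg v, (Real.sq_sqrt hv).symm⟩
  rw [Real.sqrt_sq hr]
  set C := Real.exp ((r ^ 2 * y ^ 2 + 2 * a * y - a ^ 2) / (2 * (1 + r ^ 2))) /
    Real.sqrt (2 * Real.pi) with hC
  -- Completing the square in `g`.
  have hpt : ∀ g : ℝ, Real.exp (-(1 / 2) * g ^ 2) / Real.sqrt (2 * Real.pi) *
      Real.exp ((a + r * g) * y - (a + r * g) ^ 2 / 2) =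
      C * Real.exp (-((1 + r ^ 2) / 2) * (g - r * (y - a) / (1 + r ^ 2)) ^ 2) := by
    intro g
    rw [hC, div_mul_eq_mul_div, div_mul_eq_mul_div, ← Real.exp_add, ← Real.exp_add]
    congr 2
    have : 1 + r ^ 2 ≠ 0 := by positivity
    field_simp
    ring
  have hb : 0 < (1 + r ^ 2) / 2 := by positivity
  have hi : Integrable fun g : ℝ =>
      C * Real.exp (-((1 + r ^ 2) / 2) * (g - r * (y - a) / (1 + r ^ 2)) ^ 2) :=
    ((integrable_exp_neg_mul_sq hb).comp_sub_right (r * (y - a) / (1 + r ^ 2))).const_mul C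
  have hC0 : 0 ≤ C := by positivity
  simp_rw [← ENNReal.ofReal_mul (div_nonneg (Real.exp_pos _).le (Real.sqrt_nonneg _)), hpt]
  rw [← ofReal_integral_eq_lintegral_ofReal hi
    (Filter.Eventually.of_forall fun g => by positivity), integral_const_mul,
    integral_sub_right_eq_self (fun g : ℝ => Real.exp (-((1 + r ^ 2) / 2) * g ^ 2)),
    integral_gaussian, hC]
  congr 1
  have h1 : Real.pi / ((1 + r ^ 2) / 2) = (2 * Real.pi) / (1 + r ^ 2) := by
    field_simp
  rw [h1, Real.sqrt_div (by positivity)]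
  have h2 : Real.sqrt (2 * Real.pi) ≠ 0 := (Real.sqrt_pos.2 (by positivity)).ne'
  field_simp

/-- One step of the self-normalised (mixture) supermartingale. -/
theorem lintegral_mul_mixture_le (hm : m ≤ mΩ) (hη : Measurable[mΩ] η) (hR : 0 < R)
    (hsub : ∀ ξ : ℝ, Integrable (fun ω => Real.exp (ξ * η ω)) μ ∧
      μ[fun ω => Real.exp (ξ * η ω) | m] ≤ᵐ[μ] fun _ => Real.exp (ξ ^ 2 * R ^ 2 / 2))
    {a v : Ω → ℝ} (ha : Measurable[m] a) (hv : Measurable[m] v) (hv0 : ∀ ω, 0 ≤ v ω)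
    {W : Ω → ENNReal} (hW : Measurable[m] W) :
    ∫⁻ ω, W ω * ENNReal.ofReal
      (Real.exp ((v ω * η ω ^ 2 + 2 * a ω * η ω - a ω ^ 2) / (1 + v ω) / (2 * R ^ 2)) /
        Real.sqrt (1 + v ω)) ∂μ ≤ ∫⁻ ω, W ω ∂μ := by
  have ha' : Measurable[mΩ] a := ha.mono hm le_rfl
  have hv' : Measurable[mΩ] v := hv.mono hm le_rfl
  have hW' : Measurable[mΩ] W := hW.mono hm le_rfl
  set w : ℝ → ENNReal := fun g =>
    ENNReal.ofReal (Real.exp (-(1 / 2) * g ^ 2) / Real.sqrt (2 * Real.pi)) with hw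
  have hwm : Measurable w := by fun_prop
  -- The total mass of the Gaussian density is the mixture formula with all parameters zero.
  have hw1 : ∫⁻ g, w g = 1 := by
    have := lintegral_gaussian_mixture 0 0 0 le_rfl
    simpa [hw] using this
  -- For standard Gaussian `g` this has mean `a / R²` and variance `v / R²`: with prior covariance
  -- `R² κ / λ` and noise variance `R²`, it is `R⁻²` times the Gaussian posterior prediction with
  -- mean `a` and variance `R² v`.
  set ξ : ℝ → Ω → ℝ := fun g ω => (a ω / R + Real.sqrt (v ω) * g) / R with hξ
  have hpt : ∀ ω, W ω * ENNReal.ofReal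
      (Real.exp ((v ω * η ω ^ 2 + 2 * a ω * η ω - a ω ^ 2) / (1 + v ω) / (2 * R ^ 2)) /
        Real.sqrt (1 + v ω)) =
      ∫⁻ g, w g * (W ω * ENNReal.ofReal (Real.exp (ξ g ω * η ω - ξ g ω ^ 2 * R ^ 2 / 2))) := by
    intro ω
    have h1 : (v ω * η ω ^ 2 + 2 * a ω * η ω - a ω ^ 2) / (1 + v ω) / (2 * R ^ 2) =
        (v ω * (η ω / R) ^ 2 + 2 * (a ω / R) * (η ω / R) - (a ω / R) ^ 2) / (2 * (1 + v ω)) := by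
      have := hv0 ω
      have : 1 + v ω ≠ 0 := by positivity
      field_simp
    rw [h1, ← lintegral_gaussian_mixture _ _ _ (hv0 ω), ← lintegral_const_mul _ (by fun_prop)]
    refine lintegral_congr fun g => ?_
    have h2 : (a ω / R + Real.sqrt (v ω) * g) * (η ω / R) -
        (a ω / R + Real.sqrt (v ω) * g) ^ 2 / 2 = ξ g ω * η ω - ξ g ω ^ 2 * R ^ 2 / 2 := by
      simp only [hξ]
      field_simp
    rw [h2, mul_left_comm]
  simp_rw [hpt]
  rw [lintegral_lintegral_swap (by fun_prop)]
  calc _ = ∫⁻ g, w g * ∫⁻ ω, W ω *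
        ENNReal.ofReal (Real.exp (ξ g ω * η ω - ξ g ω ^ 2 * R ^ 2 / 2)) ∂μ :=
        lintegral_congr fun g => lintegral_const_mul _ (by fun_prop)
    _ ≤ ∫⁻ g, w g * ∫⁻ ω, W ω ∂μ := by
        refine lintegral_mono fun g => mul_le_mul_right
          (lintegral_mul_exp_tilt_le hm hη hsub ?_ hW) _
        exact ((ha.div_const R).add (hv.sqrt.mul_const g)).div_const R
    _ = ∫⁻ ω, W ω ∂μ := by rw [lintegral_mul_const _ hwm, hw1, one_mul]

/-- A conditionally `0`-sub-Gaussian variable vanishes almost surely. -/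
theorem ae_eq_zero_of_condSubGaussian_zero (hm : m ≤ mΩ)
    (hsub : ∀ ξ : ℝ, Integrable (fun ω => Real.exp (ξ * η ω)) μ ∧
      μ[fun ω => Real.exp (ξ * η ω) | m] ≤ᵐ[μ] fun _ => Real.exp (ξ ^ 2 * 0 ^ 2 / 2)) :
    ∀ᵐ ω ∂μ, η ω = 0 := by
  have hle : ∀ ξ : ℝ, ∫ ω, Real.exp (ξ * η ω) ∂μ ≤ 1 := by
    intro ξ
    rw [← integral_condExp hm]
    refine (integral_mono_ae integrable_condExp (integrable_const _) (hsub ξ).2).trans ?_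
    simp
  have hi1 := (hsub 1).1
  have hi2 := (hsub (-1)).1
  -- `e^η + e^(-η) - 2` is nonnegative and vanishes only at `η = 0`, while the two moment bounds
  -- make its integral at most zero.
  have hpos : ∀ ω, 0 ≤ Real.exp (1 * η ω) + Real.exp (-1 * η ω) - 2 := by
    intro ω
    have := Real.one_le_cosh (η ω)
    rw [Real.cosh_eq] at this
    simp only [one_mul, neg_mul]
    linarith
  have hi : Integrable (fun ω => Real.exp (1 * η ω) + Real.exp (-1 * η ω) - 2) μ :=
    (hi1.add hi2).sub (integrable_const _)
  have hint : ∫ ω, (Real.exp (1 * η ω) + Real.exp (-1 * η ω) - 2) ∂μ = 0 := by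
    refine le_antisymm ?_ (integral_nonneg hpos)
    rw [integral_sub (f := fun ω => Real.exp (1 * η ω) + Real.exp (-1 * η ω))
      (hi1.add hi2) (integrable_const _), integral_add hi1 hi2]
    have h1 := hle 1
    have h2 := hle (-1)
    simp only [integral_const, probReal_univ, smul_eq_mul, one_mul] at h1 h2 ⊢
    linarith
  filter_upwards [(integral_eq_zero_iff_of_nonneg hpos hi).1 hint] with ω hω
  by_contra hne
  have := Real.one_lt_cosh.2 hne
  rw [Real.cosh_eq] at this
  simp only [one_mul, neg_mul, Pi.zero_apply] at hω
  linarith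

omit [IsProbabilityMeasure μ] in
/-- Ville's maximal inequality for a nonnegative supermartingale up to a finite horizon. -/
theorem mul_measure_exists_lt_le (ℱ : Filtration ℕ mΩ) {M : ℕ → Ω → ENNReal}
    (hM : ∀ t, Measurable[ℱ t] (M t))
    (hstep : ∀ t G, MeasurableSet[ℱ t] G → ∫⁻ ω in G, M (t + 1) ω ∂μ ≤ ∫⁻ ω in G, M t ω ∂μ)
    (C : ENNReal) (T : ℕ) :
    C * μ {ω | ∃ t ≤ T, C < M t ω} ≤ ∫⁻ ω, M 0 ω ∂μ := by
  set G : ℕ → Set Ω := fun t => {ω | ∀ s ≤ t, M s ω ≤ C} with hG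
  have hGm : ∀ t, MeasurableSet[ℱ t] (G t) := by
    intro t
    have : G t = ⋂ s ∈ Finset.range (t + 1), {ω | M s ω ≤ C} := by
      ext ω; simp [hG]
    rw [this]
    refine Finset.measurableSet_biInter _ fun s hs => ?_
    have hs' : s ≤ t := Nat.lt_succ_iff.1 (Finset.mem_range.1 hs)
    exact ℱ.mono hs' _ (measurableSet_le (hM s) measurable_const)
  have hGm' : ∀ t, MeasurableSet[mΩ] (G t) := fun t => ℱ.le t _ (hGm t)
  -- Stopping at the first crossing, without a stopping time: the mass of `M t` where `C` has not
  -- been exceeded, plus `C` times the probability that it has.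
  have key : ∀ t, ∫⁻ ω in G t, M t ω ∂μ + C * μ (G t)ᶜ ≤ ∫⁻ ω, M 0 ω ∂μ := by
    intro t
    induction t with
    | zero =>
      rw [← lintegral_add_compl (μ := μ) (M 0) (hGm' 0)]
      refine add_le_add le_rfl ?_
      rw [← setLIntegral_const]
      refine setLIntegral_mono' (hGm' 0).compl fun ω hω => ?_
      simp only [hG, Set.mem_compl_iff, Set.mem_ofPred_eq, not_forall, not_le] at hω
      obtain ⟨s, hs, h⟩ := hω
      rw [Nat.le_zero.1 hs] at h
      exact h.le
    | succ t ih =>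
      have hsub : G (t + 1) ⊆ G t := fun ω hω s hs => hω s (hs.trans (Nat.le_succ t))
      have hdiff : (G (t + 1))ᶜ = (G t)ᶜ ∪ (G t \ G (t + 1)) := by
        ext ω
        by_cases h1 : ω ∈ G (t + 1)
        · simp [h1, hsub h1]
        · by_cases h2 : ω ∈ G t <;> simp [h1, h2]
      have hbd : C * μ (G t \ G (t + 1)) ≤ ∫⁻ ω in G t \ G (t + 1), M (t + 1) ω ∂μ := by
        rw [← setLIntegral_const]
        refine setLIntegral_mono' ((hGm' t).diff (hGm' (t + 1))) fun ω hω => ?_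
        by_contra hlt
        refine hω.2 fun s hs => ?_
        rcases Nat.le_succ_iff.1 hs with h | h
        · exact hω.1 s h
        · exact h ▸ (not_le.1 hlt).le
      calc ∫⁻ ω in G (t + 1), M (t + 1) ω ∂μ + C * μ (G (t + 1))ᶜ
          ≤ ∫⁻ ω in G (t + 1), M (t + 1) ω ∂μ +
            (C * μ (G t)ᶜ + ∫⁻ ω in G t \ G (t + 1), M (t + 1) ω ∂μ) := by
            rw [hdiff]
            gcongr
            refine (mul_le_mul_right (measure_union_le _ _) C).trans ?_
            rw [mul_add]
            gcongr
        _ = ∫⁻ ω in G t, M (t + 1) ω ∂μ + C * μ (G t)ᶜ := by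
            rw [add_comm (C * _), ← add_assoc,
              ← lintegral_inter_add_sdiff (M (t + 1)) (G t) (hGm' (t + 1)),
              Set.inter_eq_self_of_subset_right hsub]
        _ ≤ _ := (add_le_add_left (hstep t _ (hGm t)) _).trans ih
  refine le_trans ?_ ((le_add_self).trans (key T))
  gcongr
  rintro ω ⟨t, ht, h⟩ hω
  exact absurd (hω t ht) (not_le.2 h)

end Tilt

/-! ### Measurability of the ridge quantities. -/

section Measurability

variable {Ω 𝒳 : Type*} [MeasurableSpace 𝒳] {κ : 𝒳 → 𝒳 → ℝ} {m : MeasurableSpace Ω}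

theorem measurable_of_forall_entry {ι : Type*} [Fintype ι] {G : Ω → Matrix ι ι ℝ}
    (hG : ∀ i j, Measurable[m] fun ω => G ω i j) {f : (ι → ι → ℝ) → ℝ} (hf : Continuous f) :
    Measurable[m] fun ω => f (G ω) :=
  hf.measurable.comp (measurable_pi_lambda _ fun i => measurable_pi_lambda _ fun j => hG i j)

variable {ι : Type*} [Fintype ι] [DecidableEq ι]

/-- Determinant and adjugate are continuous in the entries. Singular matrices need no exclusion, as
inversion of the determinant is measurable with `0⁻¹ = 0`. -/
theorem measurable_inv_entry {G : Ω → Matrix ι ι ℝ}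
    (hG : ∀ i j, Measurable[m] fun ω => G ω i j) (i j : ι) :
    Measurable[m] fun ω => (G ω)⁻¹ i j := by
  have h1 : Measurable[m] fun ω => (G ω).det :=
    measurable_of_forall_entry hG (f := fun A => Matrix.det (Matrix.of A))
      (Continuous.matrix_det continuous_id)
  have h2 : Measurable[m] fun ω => (G ω).adjugate i j :=
    measurable_of_forall_entry hG (f := fun A => Matrix.adjugate (Matrix.of A) i j)
      ((Continuous.matrix_adjugate continuous_id).matrix_elem i j)
  simp only [Matrix.inv_def, Ring.inverse_eq_inv', Matrix.smul_apply, smul_eq_mul]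
  exact h1.inv.mul h2

variable (hκ : Measurable (Function.uncurry κ)) {lam : ℝ} {z : ι → Ω → 𝒳} {e f : ι → Ω → ℝ}
  {q : Ω → 𝒳}
include hκ

theorem measurable_kernel_comp {a b : Ω → 𝒳} (ha : Measurable[m] a) (hb : Measurable[m] b) :
    Measurable[m] fun ω => κ (a ω) (b ω) :=
  hκ.comp (ha.prodMk hb)

theorem measurable_dotProduct_inv_mulVec (hz : ∀ i, Measurable[m] (z i))
    (he : ∀ i, Measurable[m] (e i)) (hf : ∀ i, Measurable[m] (f i)) :
    Measurable[m] fun ω => (fun i => e i ω) ⬝ᵥ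
      ((gram κ (fun i => z i ω) + lam • (1 : Matrix ι ι ℝ))⁻¹ *ᵥ (fun i => f i ω)) := by
  simp only [dotProduct, Matrix.mulVec]
  refine Finset.measurable_sum _ fun i _ => (he i).mul (Finset.measurable_sum _ fun j _ =>
    (measurable_inv_entry (fun k l => ?_) i j).mul (hf j))
  exact (measurable_kernel_comp hκ (hz k) (hz l)).add measurable_const

theorem measurable_krrMean (hz : ∀ i, Measurable[m] (z i)) (he : ∀ i, Measurable[m] (e i))
    (hq : Measurable[m] q) :
    Measurable[m] fun ω => krrMean κ lam (fun i => z i ω) (fun i => e i ω) (q ω) :=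
  measurable_dotProduct_inv_mulVec hκ hz (fun i => measurable_kernel_comp hκ (hz i) hq) he

theorem measurable_ridgeVar (hz : ∀ i, Measurable[m] (z i)) (hq : Measurable[m] q) :
    Measurable[m] fun ω => ridgeVar κ lam (fun i => z i ω) (q ω) :=
  (measurable_kernel_comp hκ hq hq).sub
    (measurable_dotProduct_inv_mulVec hκ hz (fun i => measurable_kernel_comp hκ (hz i) hq)
      fun i => measurable_kernel_comp hκ (hz i) hq)

theorem measurable_ridgeEnergy (hz : ∀ i, Measurable[m] (z i)) (he : ∀ i, Measurable[m] (e i)) :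
    Measurable[m] fun ω => ridgeEnergy κ lam (fun i => z i ω) (fun i => e i ω) := by
  refine Measurable.sub ?_ ((measurable_dotProduct_inv_mulVec hκ hz he he).const_mul lam)
  exact Finset.measurable_sum _ fun i _ => (he i).mul (he i)

theorem measurable_infoGain (hz : ∀ i, Measurable[m] (z i)) :
    Measurable[m] fun ω => infoGain κ lam (fun i => z i ω) := by
  refine Measurable.const_mul (Real.measurable_log.comp ?_) _
  refine measurable_of_forall_entry
    (G := fun ω => (1 : Matrix ι ι ℝ) + lam⁻¹ • gram κ (fun i => z i ω)) (fun i j => ?_)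
    (f := fun A => Matrix.det (Matrix.of A)) (Continuous.matrix_det continuous_id)
  exact measurable_const.add ((measurable_kernel_comp hκ (hz i) (hz j)).const_mul lam⁻¹)

end Measurability

/-! ### The random set of observed rounds. -/

section ObservedRounds

variable {Ω : Type*} {D : ℕ → Set Ω}

theorem mem_observedRounds {t s : ℕ} {ω : Ω} :
    s ∈ observedRounds D t ω ↔ s < t ∧ ω ∈ D s := by
  simp [observedRounds]

theorem observedRounds_subset_range {t : ℕ} {ω : Ω} : observedRounds D t ω ⊆ Finset.range t :=
  fun _ hs => Finset.mem_range.2 (mem_observedRounds.1 hs).1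

theorem observedRounds_succ_of_mem {t : ℕ} {ω : Ω} (h : ω ∈ D t) :
    observedRounds D (t + 1) ω = insert t (observedRounds D t ω) := by
  ext s
  simp only [mem_observedRounds, Finset.mem_insert]
  constructor
  · rintro ⟨h1, h2⟩
    rcases Nat.lt_succ_iff_lt_or_eq.1 h1 with h | h
    · exact Or.inr ⟨h, h2⟩
    · exact Or.inl h
  · rintro (rfl | ⟨h1, h2⟩)
    · exact ⟨Nat.lt_succ_self _, h⟩
    · exact ⟨h1.trans (Nat.lt_succ_self _), h2⟩

theorem observedRounds_succ_of_notMem {t : ℕ} {ω : Ω} (h : ω ∉ D t) :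
    observedRounds D (t + 1) ω = observedRounds D t ω := by
  ext s
  simp only [mem_observedRounds]
  constructor
  · rintro ⟨h1, h2⟩
    rcases Nat.lt_succ_iff_lt_or_eq.1 h1 with h' | h'
    · exact ⟨h', h2⟩
    · exact absurd (h' ▸ h2) h
  · rintro ⟨h1, h2⟩
    exact ⟨h1.trans (Nat.lt_succ_self _), h2⟩

theorem notMem_observedRounds_self {t : ℕ} {ω : Ω} : t ∉ observedRounds D t ω := by
  simp [mem_observedRounds]

/-- A quantity computed from the data of the observed rounds is measurable with respect to any
σ-algebra that contains the decisions and for which it is measurable on each fixed set of rounds. -/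
theorem measurable_observedRounds_comp {m : MeasurableSpace Ω} {β : Type*} [MeasurableSpace β]
    {t : ℕ} (hD : ∀ s < t, MeasurableSet[m] (D s)) {g : Finset ℕ → Ω → β}
    (hg : ∀ F ⊆ Finset.range t, Measurable[m] (g F)) :
    Measurable[m] fun ω => g (observedRounds D t ω) ω := by
  have hfib : ∀ F : Finset ℕ, MeasurableSet[m] {ω | observedRounds D t ω = F} := by
    intro F
    by_cases hF : F ⊆ Finset.range t
    · have : {ω | observedRounds D t ω = F} =
          ⋂ s ∈ Finset.range t, if s ∈ F then D s else (D s)ᶜ := by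
        ext ω
        simp only [Set.mem_ofPred_eq, Set.mem_iInter]
        constructor
        · rintro rfl s hs
          by_cases h : ω ∈ D s <;> simp [mem_observedRounds, h, Finset.mem_range.1 hs]
        · intro h
          ext s
          rw [mem_observedRounds]
          constructor
          · rintro ⟨h1, h2⟩
            by_contra h3
            have := h s (Finset.mem_range.2 h1)
            rw [if_neg h3] at this
            exact this h2
          · intro h1
            have := h s (hF h1)
            rw [if_pos h1] at this
            exact ⟨Finset.mem_range.1 (hF h1), this⟩
      rw [this]
      refine Finset.measurableSet_biInter _ fun s hs => ?_
      split_ifs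
      · exact hD s (Finset.mem_range.1 hs)
      · exact (hD s (Finset.mem_range.1 hs)).compl
    · have : {ω | observedRounds D t ω = F} = ∅ := by
        ext ω
        simp only [Set.mem_ofPred_eq, Set.mem_empty_iff_false, iff_false]
        rintro rfl
        exact hF observedRounds_subset_range
      rw [this]
      exact MeasurableSet.empty
  intro B hB
  have : (fun ω => g (observedRounds D t ω) ω) ⁻¹' B =
      ⋃ F ∈ (Finset.range t).powerset, {ω | observedRounds D t ω = F} ∩ g F ⁻¹' B := by
    ext ω
    simp only [Set.mem_preimage, Set.mem_iUnion, Set.mem_inter_iff, Set.mem_ofPred_eq]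
    constructor
    · intro h
      exact ⟨_, Finset.mem_powerset.2 observedRounds_subset_range, rfl, h⟩
    · rintro ⟨F, _, rfl, h⟩
      exact h
  rw [this]
  exact Finset.measurableSet_biUnion _ fun F hF =>
    (hfib F).inter (hg F (Finset.mem_powerset.1 hF) hB)

end ObservedRounds

/-! ### The self-normalised supermartingale and the noise energy bound. -/

section NoiseEnergy

variable {𝒳 : Type*}

/-- The noise in the cost observations collected in the first `t` rounds. -/
def obsNoise {Ω : Type*} (η : ℕ → Ω → ℝ) (D : ℕ → Set Ω) (t : ℕ) (ω : Ω)
    (i : observedRounds D t ω) : ℝ :=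
  η i ω

/-- The normalised log-martingale `q / (2 R²) - γ`, with `q` the ridge energy of the noise and `γ`
the information gain of the data indexed by `F`. -/
noncomputable def logMixture (κ : 𝒳 → 𝒳 → ℝ) (lam R : ℝ) (X : ℕ → 𝒳) (e : ℕ → ℝ) (F : Finset ℕ) :
    ℝ :=
  ridgeEnergy κ lam (fun i : F => X i) (fun i : F => e i) / (2 * R ^ 2) -
    infoGain κ lam (fun i : F => X i)

theorem logMixture_empty (κ : 𝒳 → 𝒳 → ℝ) (lam R : ℝ) (X : ℕ → 𝒳) (e : ℕ → ℝ) :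
    logMixture κ lam R X e ∅ = 0 := by
  simp [logMixture, ridgeEnergy, infoGain, Matrix.det_isEmpty]

/-- The increment is the logarithm of the closed-form mixture factor in `lintegral_mul_mixture_le`:
the determinant update supplies `1 / √(1 + v)`. -/
theorem logMixture_insert {E : Type*} [NormedAddCommGroup E] [InnerProductSpace ℝ E]
    {κ : 𝒳 → 𝒳 → ℝ} {φ : 𝒳 → E} (hκ : ∀ x y, κ x y = inner ℝ (φ x) (φ y)) {lam : ℝ}
    (hlam : 0 < lam) (R : ℝ) (X : ℕ → 𝒳) (e : ℕ → ℝ) {F : Finset ℕ} {t : ℕ} (ht : t ∉ F)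
    {v m : ℝ} (hv : v = ridgeVar κ lam (fun i : F => X i) (X t) / lam)
    (hm : m = krrMean κ lam (fun i : F => X i) (fun i : F => e i) (X t)) :
    logMixture κ lam R X e (insert t F) = logMixture κ lam R X e F +
      ((v * e t ^ 2 + 2 * m * e t - m ^ 2) / (1 + v) / (2 * R ^ 2) -
        (1 / 2) * Real.log (1 + v)) := by
  have h1 : ridgeEnergy κ lam (fun i : ↥(insert t F) => X i) (fun i : ↥(insert t F) => e i) =
      ridgeEnergy κ lam (fun i : F => X i) (fun i : F => e i) +
        (v * e t ^ 2 + 2 * m * e t - m ^ 2) / (1 + v) := by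
    rw [← ridgeEnergy_comp_equiv _ _ (Finset.subtypeInsertEquivOption ht).symm]
    exact ridgeEnergy_option hκ hlam _ _ hv hm
  have h2 : infoGain κ lam (fun i : ↥(insert t F) => X i) =
      infoGain κ lam (fun i : F => X i) + (1 / 2) * Real.log (1 + v) := by
    rw [← infoGain_comp_equiv _ (Finset.subtypeInsertEquivOption ht).symm, hv]
    exact infoGain_option hκ hlam _
  rw [logMixture, logMixture, h1, h2]
  ring

variable [MeasurableSpace 𝒳] {E : Type*} [NormedAddCommGroup E] [InnerProductSpace ℝ E]
  {κ : 𝒳 → 𝒳 → ℝ} {φ : 𝒳 → E} {lam R : ℝ} {Ω : Type*} {mΩ : MeasurableSpace Ω} {μ : Measure Ω}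
  [IsProbabilityMeasure μ] {ℱ : Filtration ℕ mΩ} {x : ℕ → Ω → 𝒳} {D : ℕ → Set Ω} {η : ℕ → Ω → ℝ}

/-- The self-normalised concentration inequality, uniformly over a finite horizon. -/
theorem measure_exists_log_lt_logMixture_le (hφ : ∀ x y, κ x y = inner ℝ (φ x) (φ y))
    (hκ : Measurable (Function.uncurry κ)) (hlam : 0 < lam)
    (hx : ∀ s, Measurable[ℱ s] (x s)) (hD : ∀ s, MeasurableSet[ℱ s] (D s))
    (hη : ∀ s, Measurable[ℱ (s + 1)] (η s)) (hR : 0 < R) (hsub : IsCondSubGaussian μ ℱ η R)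
    {C : ℝ} (hC : 0 < C) (T : ℕ) :
    μ {ω | ∃ t ≤ T, Real.log C <
      logMixture κ lam R (fun s => x s ω) (fun s => η s ω) (observedRounds D t ω)} ≤
      ENNReal.ofReal (1 / C) := by
  classical
  set L : ℕ → Ω → ℝ := fun t ω =>
    logMixture κ lam R (fun s => x s ω) (fun s => η s ω) (observedRounds D t ω) with hL
  have hx' : ∀ {t s : ℕ}, s ≤ t → Measurable[ℱ t] (x s) := fun h => (hx _).mono (ℱ.mono h) le_rfl
  have hη' : ∀ {t s : ℕ}, s < t → Measurable[ℱ t] (η s) := fun h =>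
    (hη _).mono (ℱ.mono (Nat.succ_le_of_lt h)) le_rfl
  have hD' : ∀ {t : ℕ}, ∀ s < t, MeasurableSet[ℱ t] (D s) := fun s h =>
    ℱ.mono (le_of_lt h) _ (hD s)
  have hlt : ∀ {t : ℕ} {F : Finset ℕ}, F ⊆ Finset.range t → ∀ i : F, (i : ℕ) < t := fun hF i =>
    Finset.mem_range.1 (hF i.2)
  have hLm : ∀ t, Measurable[ℱ t] (L t) := fun t =>
    measurable_observedRounds_comp (g := fun F ω =>
      logMixture κ lam R (fun s => x s ω) (fun s => η s ω) F) hD' fun F hF =>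
      ((measurable_ridgeEnergy hκ (fun i : F => hx' (hlt hF i).le)
        fun i : F => hη' (hlt hF i)).div_const _).sub
        (measurable_infoGain hκ fun i : F => hx' (hlt hF i).le)
  set M : ℕ → Ω → ENNReal := fun t ω => ENNReal.ofReal (Real.exp (L t ω)) with hM
  have hMm : ∀ t, Measurable[ℱ t] (M t) := fun t =>
    ENNReal.measurable_ofReal.comp (Real.measurable_exp.comp (hLm t))
  have hstep : ∀ t G, MeasurableSet[ℱ t] G →
      ∫⁻ ω in G, M (t + 1) ω ∂μ ≤ ∫⁻ ω in G, M t ω ∂μ := by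
    intro t G hG
    -- Off `D t` both parameters are set to zero, so the mixture factor is 1 there and rounds with
    -- and without an observation obey the same recursion.
    set v : Ω → ℝ := (D t).indicator fun ω => ridgeVar κ lam
      (fun i : observedRounds D t ω => x i ω) (x t ω) / lam with hv
    set a : Ω → ℝ := (D t).indicator fun ω => krrMean κ lam
      (fun i : observedRounds D t ω => x i ω) (fun i : observedRounds D t ω => η i ω) (x t ω)
      with ha
    have hvm : Measurable[ℱ t] v := by
      refine (Measurable.div_const ?_ lam).indicator (hD t)
      exact measurable_observedRounds_comp (g := fun F ω => ridgeVar κ lam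
        (fun i : F => x i ω) (x t ω)) hD' fun F hF =>
        measurable_ridgeVar hκ (fun i : F => hx' (hlt hF i).le) (hx t)
    have ham : Measurable[ℱ t] a := by
      refine Measurable.indicator ?_ (hD t)
      exact measurable_observedRounds_comp (g := fun F ω => krrMean κ lam
        (fun i : F => x i ω) (fun i : F => η i ω) (x t ω)) hD' fun F hF =>
        measurable_krrMean hκ (fun i : F => hx' (hlt hF i).le)
          (fun i : F => hη' (hlt hF i)) (hx t)
    have hv0 : ∀ ω, 0 ≤ v ω := fun ω => Set.indicator_nonneg
      (fun ω _ => div_nonneg (ridgeVar_nonneg hφ hlam _ _) hlam.le) ω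
    have hrec : ∀ ω, M (t + 1) ω = M t ω * ENNReal.ofReal
        (Real.exp ((v ω * η t ω ^ 2 + 2 * a ω * η t ω - a ω ^ 2) / (1 + v ω) / (2 * R ^ 2)) /
          Real.sqrt (1 + v ω)) := by
      intro ω
      have hLrec : L (t + 1) ω = L t ω +
          ((v ω * η t ω ^ 2 + 2 * a ω * η t ω - a ω ^ 2) / (1 + v ω) / (2 * R ^ 2) -
            (1 / 2) * Real.log (1 + v ω)) := by
        by_cases h : ω ∈ D t
        · simp only [hL, observedRounds_succ_of_mem h]
          exact logMixture_insert hφ hlam R _ _ notMem_observedRounds_self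
            (Set.indicator_of_mem h _) (Set.indicator_of_mem h _)
        · simp [hL, observedRounds_succ_of_notMem h, hv, ha, h]
      have h1 : 0 < 1 + v ω := by linarith [hv0 ω]
      simp only [hM]
      rw [hLrec, Real.exp_add, ENNReal.ofReal_mul (Real.exp_pos _).le, Real.exp_sub,
        Real.sqrt_eq_rpow, Real.rpow_def_of_pos h1, mul_comm (Real.log _)]
    have hmulind : ∀ t' ω, G.indicator (M t') ω = G.indicator 1 ω * M t' ω := by
      intro t' ω
      by_cases h : ω ∈ G <;> simp [h]
    rw [← lintegral_indicator (ℱ.le t _ hG), ← lintegral_indicator (ℱ.le t _ hG)]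
    -- Restriction to `G` is absorbed into the weight.
    have hW : Measurable[ℱ t] (G.indicator (M t)) := (hMm t).indicator hG
    refine le_trans (le_of_eq (lintegral_congr fun ω => ?_))
      (lintegral_mul_mixture_le (ℱ.le t) ((hη t).mono (ℱ.le _) le_rfl) hR
        (fun ξ => (hsub t).2.2 ξ) ham hvm hv0 hW)
    rw [hmulind, hmulind, hrec]
    exact (mul_assoc _ _ _).symm
  have hM0 : ∫⁻ ω, M 0 ω ∂μ = 1 := by
    have : ∀ ω, M 0 ω = 1 := by
      intro ω
      have h0 : observedRounds D 0 ω = ∅ := by simp [observedRounds]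
      simp only [hM, hL, h0, logMixture_empty, Real.exp_zero, ENNReal.ofReal_one]
    simp [this]
  have hV := mul_measure_exists_lt_le ℱ hMm hstep (ENNReal.ofReal C) T
  rw [hM0, mul_comm, ← ENNReal.le_div_iff_mul_le (Or.inl (ENNReal.ofReal_pos.2 hC).ne')
    (Or.inl ENNReal.ofReal_ne_top)] at hV
  rw [ENNReal.ofReal_div_of_pos hC, ENNReal.ofReal_one]
  refine le_trans (measure_mono ?_) hV
  rintro ω ⟨t, ht, h⟩
  refine ⟨t, ht, ?_⟩
  rw [ENNReal.ofReal_lt_ofReal_iff (Real.exp_pos _)]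
  exact (Real.log_lt_iff_lt_exp hC).1 h

/-- With probability at least `1 - δ / 2`, the noise energy is controlled by the information
gain in all rounds. -/
theorem measure_exists_lt_ridgeEnergy_le (hφ : ∀ x y, κ x y = inner ℝ (φ x) (φ y))
    (hκ : Measurable (Function.uncurry κ)) (hlam : 0 < lam)
    (hx : ∀ s, Measurable[ℱ s] (x s)) (hD : ∀ s, MeasurableSet[ℱ s] (D s))
    (hη : ∀ s, Measurable[ℱ (s + 1)] (η s)) (hR : 0 ≤ R) (hsub : IsCondSubGaussian μ ℱ η R)
    {δ : ℝ} (hδ : 0 < δ) (T : ℕ) :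
    μ {ω | ∃ t ≤ T, R ^ 2 * (2 * (infoGain κ lam (obsInput x D t ω) + Real.log (2 / δ))) <
      ridgeEnergy κ lam (obsInput x D t ω) (obsNoise η D t ω)} ≤ ENNReal.ofReal (δ / 2) := by
  -- The supermartingale divides by `R²`. For `R = 0` the noise vanishes almost surely and the
  -- energy is zero.
  rcases hR.eq_or_lt with rfl | hR
  · have h0 : ∀ᵐ ω ∂μ, ∀ s, η s ω = 0 := ae_all_iff.2 fun s =>
      ae_eq_zero_of_condSubGaussian_zero (ℱ.le s) (hsub s).2.2
    refine le_trans (le_of_eq ?_) zero_le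
    refine measure_mono_null ?_ (ae_iff.1 h0)
    rintro ω ⟨t, _, h⟩ hω
    have : obsNoise η D t ω = 0 := funext fun i => hω i
    simp [this, ridgeEnergy] at h
  · have hC : (0 : ℝ) < 2 / δ := by positivity
    have := measure_exists_log_lt_logMixture_le hφ hκ hlam hx hD hη hR hsub hC T
    rw [one_div_div] at this
    refine le_trans (measure_mono ?_) this
    rintro ω ⟨t, ht, h⟩
    refine ⟨t, ht, ?_⟩
    change _ < ridgeEnergy κ lam (obsInput x D t ω) (obsNoise η D t ω) / (2 * R ^ 2) -
      infoGain κ lam (obsInput x D t ω)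
    rw [lt_sub_iff_add_lt, lt_div_iff₀ (by positivity)]
    linarith

end NoiseEnergy

/-! ### Concentration of the empirical cell weights. -/

section Weights

/-- If deviations `d` sum to zero and their `ℓ¹` norm exceeds `r`, then some nonempty proper set
of coordinates has total deviation at least `r / 2`. -/
theorem exists_half_le_sum_of_lt_sum_abs {α : Type*} [DecidableEq α] {S : Finset α} {d : α → ℝ}
    (hd : ∑ u ∈ S, d u = 0) {r : ℝ} (hr : 0 ≤ r) (h : r < ∑ u ∈ S, |d u|) :
    ∃ P ∈ S.powerset \ {∅, S}, r / 2 ≤ ∑ u ∈ P, d u := by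
  have hsum : ∑ u ∈ S, |d u| = 2 * ∑ u ∈ S.filter (fun u => 0 < d u), d u := by
    have h1 : ∀ u, |d u| = 2 * (if 0 < d u then d u else 0) - d u := by
      intro u
      split_ifs with hu
      · rw [abs_of_pos hu]; ring
      · rw [abs_of_nonpos (not_lt.1 hu)]; ring
    simp only [h1, Finset.sum_sub_distrib, hd, sub_zero, ← Finset.mul_sum, Finset.sum_filter]
  refine ⟨S.filter (fun u => 0 < d u), ?_, by linarith⟩
  simp only [Finset.mem_sdiff, Finset.mem_powerset, Finset.mem_insert, Finset.mem_singleton]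
  refine ⟨Finset.filter_subset _ _, ?_⟩
  -- Either excluded set would have total deviation zero and force the `ℓ¹` norm to be `0 ≤ r`.
  rintro (h0 | h0)
  · rw [hsum, h0, Finset.sum_empty] at h
    linarith
  · rw [hsum, h0, hd] at h
    linarith

variable {Ω 𝒳 : Type*} [MetricSpace 𝒳] [MeasurableSpace 𝒳] {S : Finset 𝒳} {V : 𝒳 → 𝒳}

theorem IsVoronoiAssignment.measurableSet_preimage (hV : IsVoronoiAssignment S V) {P : Finset 𝒳}
    (hP : P ⊆ S) : MeasurableSet (V ⁻¹' P) := by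
  rw [← Set.biUnion_preimage_singleton]
  exact Finset.measurableSet_biUnion _ fun u hu => hV.measurableSet_cell u (hP hu)

theorem sum_cellWeight (ν : Measure 𝒳) [IsProbabilityMeasure ν] (hV : IsVoronoiAssignment S V)
    {P : Finset 𝒳} (hP : P ⊆ S) : ∑ u ∈ P, cellWeight ν V u = ν.real (V ⁻¹' P) := by
  rw [← Set.biUnion_preimage_singleton]
  refine (measureReal_biUnion_finset (fun u _ v _ huv => ?_)
    fun u hu => hV.measurableSet_cell u (hP hu)).symm
  exact Disjoint.preimage _ (Set.disjoint_singleton.2 huv)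

omit [MetricSpace 𝒳] [MeasurableSpace 𝒳] in
theorem sum_empWeight (V : 𝒳 → 𝒳) (x : ℕ → Ω → 𝒳) (t : ℕ) (ω : Ω) (P : Finset 𝒳) :
    ∑ u ∈ P, empWeight V x t ω u =
      (∑ s ∈ Finset.range t, (V ⁻¹' (P : Set 𝒳)).indicator (1 : 𝒳 → ℝ) (x s ω)) / t := by
  classical
  simp only [empWeight, ← Finset.sum_div]
  congr 1
  simp only [Finset.card_filter, Nat.cast_sum, Nat.cast_ite, Nat.cast_one, Nat.cast_zero]
  rw [Finset.sum_comm]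
  refine Finset.sum_congr rfl fun s _ => ?_
  rw [Finset.sum_ite_eq]
  simp [Set.indicator]

theorem sum_empWeight_sub_cellWeight (ν : Measure 𝒳) [IsProbabilityMeasure ν]
    (hV : IsVoronoiAssignment S V) (x : ℕ → Ω → 𝒳) {t : ℕ} (ht : 1 ≤ t) (ω : Ω) :
    ∑ u ∈ S, empWeight V x t ω u = 1 ∧ ∑ u ∈ S, cellWeight ν V u = 1 := by
  have hall : V ⁻¹' (S : Set 𝒳) = Set.univ := Set.eq_univ_of_forall hV.mem
  have ht' : (t : ℝ) ≠ 0 := by positivity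
  rw [sum_empWeight, sum_cellWeight ν hV subset_rfl, hall]
  simp [ht']

variable {mΩ : MeasurableSpace Ω} {μ : Measure Ω} [IsProbabilityMeasure μ] {ν : Measure 𝒳}
  [IsProbabilityMeasure ν] {x : ℕ → Ω → 𝒳}

/-- Hoeffding for the indicators of the union of cells: they take values in `[0, 1]`, so the
variance proxy is `1 / 4`, and a deviation `t r / 2` of the sum gives the exponent `t r² / 2`. -/
theorem measureReal_le_sum_empWeight_sub_le (hx_indep : iIndepFun x μ)
    (hx_law : ∀ s, μ.map (x s) = ν) (hx : ∀ s, Measurable (x s)) (hV : IsVoronoiAssignment S V)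
    {P : Finset 𝒳} (hP : P ⊆ S) {t : ℕ} (ht : 1 ≤ t) {r : ℝ} (hr : 0 ≤ r) :
    μ.real {ω | r / 2 ≤ ∑ u ∈ P, (empWeight V x t ω u - cellWeight ν V u)} ≤
      Real.exp (-(t * r ^ 2 / 2)) := by
  have hB := hV.measurableSet_preimage hP
  set f : 𝒳 → ℝ := (V ⁻¹' (P : Set 𝒳)).indicator 1 with hf
  have hfm : Measurable f := measurable_const.indicator hB
  have ht' : (0 : ℝ) < t := by positivity
  have hmean : ∀ s, ∫ ω, f (x s ω) ∂μ = ∑ u ∈ P, cellWeight ν V u := by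
    intro s
    rw [← integral_map (hx s).aemeasurable hfm.aestronglyMeasurable, hx_law,
      integral_indicator_one hB, sum_cellWeight ν hV hP]
  have hsubG : ∀ s, HasSubgaussianMGF (fun ω => f (x s ω) - ∑ u ∈ P, cellWeight ν V u)
      ((‖(1 : ℝ) - 0‖₊ / 2) ^ 2) μ := by
    intro s
    rw [← hmean s]
    refine hasSubgaussianMGF_of_mem_Icc (hfm.comp (hx s)).aemeasurable
      (Filter.Eventually.of_forall fun ω => ?_)
    simp only [hf, Set.indicator]
    split_ifs <;> simp
  have hind : iIndepFun (fun s ω => f (x s ω) - ∑ u ∈ P, cellWeight ν V u) μ :=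
    hx_indep.comp (fun _ q => f q - ∑ u ∈ P, cellWeight ν V u) fun _ => hfm.sub_const _
  have h := HasSubgaussianMGF.measure_sum_range_ge_le_of_iIndepFun hind (n := t)
    (fun s _ => hsubG s) (ε := t * (r / 2)) (by positivity)
  have hset : {ω | r / 2 ≤ ∑ u ∈ P, (empWeight V x t ω u - cellWeight ν V u)} =
      {ω | t * (r / 2) ≤ ∑ s ∈ Finset.range t, (f (x s ω) - ∑ u ∈ P, cellWeight ν V u)} := by
    ext ω
    simp only [Set.mem_ofPred_eq]
    rw [Finset.sum_sub_distrib, Finset.sum_sub_distrib, sum_empWeight, Finset.sum_const,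
      Finset.card_range, nsmul_eq_mul, le_sub_iff_add_le, le_div_iff₀ ht', le_sub_iff_add_le]
    constructor <;> intro h <;> linarith
  rw [hset]
  refine h.trans (Real.exp_le_exp.2 (le_of_eq ?_))
  have h1 : (((‖(1 : ℝ) - 0‖₊ / 2) ^ 2 : ℝ≥0) : ℝ) = 1 / 4 := by
    norm_num
  rw [h1]
  field_simp
  norm_num

/-- The Bretagnolle–Huber-Carol inequality for the empirical cell weights. -/
theorem measureReal_lt_sum_abs_empWeight_sub_le (hx_indep : iIndepFun x μ)
    (hx_law : ∀ s, μ.map (x s) = ν) (hx : ∀ s, Measurable (x s)) (hV : IsVoronoiAssignment S V)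
    (hS : S.Nonempty) {t : ℕ} (ht : 1 ≤ t) {r : ℝ} (hr : 0 ≤ r) :
    μ.real {ω | r < ∑ u ∈ S, |empWeight V x t ω u - cellWeight ν V u|} ≤
      (2 ^ S.card - 2) * Real.exp (-(t * r ^ 2 / 2)) := by
  classical
  have hcard : ((S.powerset \ {∅, S}).card : ℝ) = 2 ^ S.card - 2 := by
    have hsub : ({∅, S} : Finset (Finset 𝒳)) ⊆ S.powerset := by
      intro P hP
      rcases Finset.mem_insert.1 hP with rfl | h
      · simp
      · simp [Finset.mem_singleton.1 h]
    rw [Finset.card_sdiff_of_subset hsub, Nat.cast_sub (Finset.card_le_card hsub),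
      Finset.card_powerset, Finset.card_pair hS.ne_empty.symm]
    simp
  calc _ ≤ μ.real (⋃ P ∈ S.powerset \ {∅, S},
        {ω | r / 2 ≤ ∑ u ∈ P, (empWeight V x t ω u - cellWeight ν V u)}) := by
        refine measureReal_mono (fun ω hω => ?_) (measure_ne_top _ _)
        obtain ⟨h1, h2⟩ := sum_empWeight_sub_cellWeight ν hV x ht ω
        obtain ⟨P, hP, h⟩ := exists_half_le_sum_of_lt_sum_abs
          (by rw [Finset.sum_sub_distrib, h1, h2, sub_self]) hr hω
        exact Set.mem_biUnion (Finset.mem_coe.2 hP) h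
    _ ≤ ∑ P ∈ S.powerset \ {∅, S},
        μ.real {ω | r / 2 ≤ ∑ u ∈ P, (empWeight V x t ω u - cellWeight ν V u)} :=
        measureReal_biUnion_finset_le _ _
    _ ≤ ∑ P ∈ S.powerset \ {∅, S}, Real.exp (-(t * r ^ 2 / 2)) :=
        Finset.sum_le_sum fun P hP => measureReal_le_sum_empWeight_sub_le hx_indep hx_law hx hV
          (Finset.mem_powerset.1 (Finset.mem_sdiff.1 hP).1) ht hr
    _ = _ := by rw [Finset.sum_const, nsmul_eq_mul, hcard]

theorem sum_abs_empWeight_sub_le_two (hV : IsVoronoiAssignment S V) {t : ℕ} (ht : 1 ≤ t) (ω : Ω) :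
    ∑ u ∈ S, |empWeight V x t ω u - cellWeight ν V u| ≤ 2 := by
  obtain ⟨h1, h2⟩ := sum_empWeight_sub_cellWeight ν hV x ht ω
  calc _ ≤ ∑ u ∈ S, (empWeight V x t ω u + cellWeight ν V u) := by
        refine Finset.sum_le_sum fun u _ => ?_
        have ha : 0 ≤ empWeight V x t ω u := by unfold empWeight; positivity
        have hb : 0 ≤ cellWeight ν V u := measureReal_nonneg
        exact abs_le.2 ⟨by linarith, by linarith⟩
    _ = 2 := by rw [Finset.sum_add_distrib, h1, h2]; norm_num

/-- Settles the single-round case with `k ≥ 3`, where the bound already exceeds the trivial value 2,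
since `6 log 2 > 4`. -/
theorem two_le_sqrt_mul_log {k : ℕ} (hk : 3 ≤ k) {δ : ℝ} (hδ0 : 0 < δ) (hδ1 : δ ≤ 1) :
    2 ≤ Real.sqrt (2 * k * Real.log (2 / δ)) := by
  refine Real.le_sqrt_of_sq_le ?_
  have hl : Real.log 2 ≤ Real.log (2 / δ) :=
    Real.log_le_log two_pos ((le_div_iff₀ hδ0).2 (by linarith))
  have hk' : (3 : ℝ) ≤ k := by exact_mod_cast hk
  have := Real.log_two_gt_d9
  have h6 : 3 * 0.69 ≤ (k : ℝ) * Real.log (2 / δ) :=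
    mul_le_mul hk' (by linarith) (by norm_num) (by positivity)
  linarith

/-- Anytime concentration of the empirical cell weights over the first `T` rounds. -/
theorem measureReal_exists_lt_sum_abs_empWeight_sub_le (hx_indep : iIndepFun x μ)
    (hx_law : ∀ s, μ.map (x s) = ν) (hx : ∀ s, Measurable (x s)) (hV : IsVoronoiAssignment S V)
    {k : ℕ} (hk : S.card ≤ k) {δ : ℝ} (hδ0 : 0 < δ) (hδ1 : δ < 1) {T : ℕ} (hT : 1 ≤ T) :
    μ.real {ω | ∃ t ∈ Finset.Icc 1 T, Real.sqrt (2 * k * Real.log (2 * (T : ℝ) ^ 2 / δ) / t) <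
      ∑ u ∈ S, |empWeight V x t ω u - cellWeight ν V u|} ≤ δ / 2 := by
  have hT' : (1 : ℝ) ≤ T := by exact_mod_cast hT
  have hlog : 0 < Real.log (2 * (T : ℝ) ^ 2 / δ) := by
    refine Real.log_pos ((one_lt_div hδ0).2 ?_)
    nlinarith
  -- `S` is nonempty because `V` takes its values in it and some query exists.
  obtain ⟨ω₀⟩ : Nonempty Ω := nonempty_of_isProbabilityMeasure μ
  have hS : S.Nonempty := ⟨_, hV.mem (x 0 ω₀)⟩
  -- With this choice the exponential tail at the stated radius is exactly `ρ ^ k`.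
  set ρ : ℝ := δ / (2 * (T : ℝ) ^ 2) with hρ
  have hρ0 : 0 < ρ := by positivity
  have hbound : ∀ t ∈ Finset.Icc 1 T,
      μ.real {ω | Real.sqrt (2 * k * Real.log (2 * (T : ℝ) ^ 2 / δ) / t) <
        ∑ u ∈ S, |empWeight V x t ω u - cellWeight ν V u|} ≤ (2 ^ S.card - 2) * ρ ^ k := by
    intro t ht
    have ht1 := (Finset.mem_Icc.1 ht).1
    have ht' : (0 : ℝ) < t := by positivity
    refine (measureReal_lt_sum_abs_empWeight_sub_le hx_indep hx_law hx hV hS ht1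
      (Real.sqrt_nonneg _)).trans (le_of_eq ?_)
    rw [Real.sq_sqrt (by positivity)]
    congr 1
    have h1 : -(t * (2 * k * Real.log (2 * (T : ℝ) ^ 2 / δ) / t) / 2) = k * Real.log ρ := by
      have : Real.log ρ = -Real.log (2 * (T : ℝ) ^ 2 / δ) := by
        rw [← Real.log_inv, inv_div]
      rw [this]
      field_simp
    rw [h1, ← Real.log_pow, Real.exp_log (by positivity)]
  have hunion : μ.real {ω | ∃ t ∈ Finset.Icc 1 T,
      Real.sqrt (2 * k * Real.log (2 * (T : ℝ) ^ 2 / δ) / t) <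
        ∑ u ∈ S, |empWeight V x t ω u - cellWeight ν V u|} ≤ T * ((2 ^ S.card - 2) * ρ ^ k) := by
    have hset : {ω | ∃ t ∈ Finset.Icc 1 T,
        Real.sqrt (2 * k * Real.log (2 * (T : ℝ) ^ 2 / δ) / t) <
          ∑ u ∈ S, |empWeight V x t ω u - cellWeight ν V u|} =
        ⋃ t ∈ Finset.Icc 1 T, {ω | Real.sqrt (2 * k * Real.log (2 * (T : ℝ) ^ 2 / δ) / t) <
          ∑ u ∈ S, |empWeight V x t ω u - cellWeight ν V u|} := by
      ext ω
      simp
    rw [hset]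
    refine (measureReal_biUnion_finset_le _ _).trans ((Finset.sum_le_sum hbound).trans ?_)
    simp
  -- With a single cell the prefactor `2 ^ |S| - 2` is zero.
  rcases Nat.lt_or_ge S.card 2 with hc | hc
  · have : S.card = 1 := le_antisymm (Nat.lt_succ_iff.1 hc) hS.card_pos
    refine hunion.trans ?_
    rw [this]
    norm_num
    linarith
  have hk2 : 2 ≤ k := hc.trans hk
  -- The crude estimate `(2 ρ) ^ k ≤ (2 ρ)²` gives only `δ²` when `T = 1`. There `k = 2` keeps the
  -- exact prefactor, giving `δ² / 2`, and `k ≥ 3` is trivial. For `T ≥ 2` the union bound gives `δ²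
  -- / T³`.
  rcases eq_or_lt_of_le hT with rfl | hT2
  · rcases eq_or_lt_of_le hk2 with rfl | hk3
    · refine hunion.trans ?_
      rw [le_antisymm hk hc, hρ]
      norm_num
      nlinarith
    · refine (le_of_eq ?_).trans (half_pos hδ0).le
      convert measureReal_empty (μ := μ)
      refine Set.eq_empty_of_forall_notMem ?_
      rintro ω ⟨t, ht, h⟩
      obtain rfl : t = 1 := by simpa using ht
      refine not_le.2 h ((sum_abs_empWeight_sub_le_two hV le_rfl ω).trans ?_)
      simpa using two_le_sqrt_mul_log hk3 hδ0 hδ1.le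
  · have hT2' : (2 : ℝ) ≤ T := by exact_mod_cast hT2
    refine hunion.trans ?_
    have h2ρ : 2 * ρ = δ / (T : ℝ) ^ 2 := by
      rw [hρ]
      field_simp
    have h2ρ1 : 2 * ρ ≤ 1 := by
      rw [h2ρ, div_le_one (by positivity)]
      nlinarith
    have h1 : ((2 : ℝ) ^ S.card - 2) * ρ ^ k ≤ (2 * ρ) ^ 2 := by
      calc ((2 : ℝ) ^ S.card - 2) * ρ ^ k ≤ 2 ^ k * ρ ^ k := by
            gcongr
            have : (2 : ℝ) ^ S.card ≤ 2 ^ k := pow_le_pow_right₀ one_le_two hk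
            linarith
        _ = (2 * ρ) ^ k := (mul_pow _ _ _).symm
        _ ≤ (2 * ρ) ^ 2 := pow_le_pow_of_le_one (by positivity) h2ρ1 hk2
    calc (T : ℝ) * ((2 ^ S.card - 2) * ρ ^ k) ≤ T * (2 * ρ) ^ 2 := by gcongr
      _ = δ * (δ / (T : ℝ) ^ 3) := by
          rw [h2ρ]
          field_simp
      _ ≤ δ * (1 / 2) := by
          gcongr
          have : (2 : ℝ) ^ 3 ≤ (T : ℝ) ^ 3 := by gcongr
          linarith
      _ = δ / 2 := by ring

end Weights

/-! ### Specialisation to the reproducing kernel space, and the conclusion. -/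

section Main

variable {Ω 𝒳 H : Type*} [NormedAddCommGroup H] [InnerProductSpace ℝ H] [CompleteSpace H]
  [RKHS ℝ H 𝒳 ℝ]

/-- Identifies the feature map as `p ↦ RKHS.kerFun H p 1`, to which the abstract ridge bounds are
applied. -/
theorem scalarKernel_eq_inner (p q : 𝒳) :
    scalarKernel H p q = inner ℝ (RKHS.kerFun H p (1 : ℝ)) (RKHS.kerFun H q (1 : ℝ)) := by
  rw [RKHS.kerFun_inner, RKHS.kerFun_apply]
  simp [scalarKernel]

/-- The confidence bound, on the event that the noise energy is controlled. -/
theorem abs_costEstimate_sub_le_confRadius (c : H) {B lam R δ : ℝ} (hB : ‖c‖ ≤ B) (hlam : 1 ≤ lam)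
    (hR : 0 ≤ R) {x : ℕ → Ω → 𝒳} {D : ℕ → Set Ω} {η : ℕ → Ω → ℝ} {t : ℕ} {ω : Ω}
    (h : ridgeEnergy (scalarKernel H) lam (obsInput x D t ω) (obsNoise η D t ω) ≤
      R ^ 2 * (2 * (infoGain (scalarKernel H) lam (obsInput x D t ω) + Real.log (2 / δ))))
    (q : 𝒳) :
    |costEstimate (scalarKernel H) lam c x η D t ω q - c q| ≤
      confRadius (scalarKernel H) lam B R δ x D t ω q := by
  have hc : ∀ p : 𝒳, inner ℝ c (RKHS.kerFun H p (1 : ℝ)) = c p := fun p => by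
    rw [RKHS.inner_kerFun]
    simp
  have h1 := abs_krrMean_noisy_sub_le (φ := fun p => RKHS.kerFun H p (1 : ℝ))
    scalarKernel_eq_inner hlam (obsInput x D t ω) c (obsNoise η D t ω) q
  simp only [hc] at h1
  refine h1.trans (mul_le_mul_of_nonneg_right (add_le_add hB ?_) (Real.sqrt_nonneg _))
  nth_rewrite 1 [← Real.sqrt_sq hR]
  rw [← Real.sqrt_mul (sq_nonneg R)]
  exact Real.sqrt_le_sqrt h

end Main

theorem lemma5p1
    -- the query space, a function space on it with its kernel, and the true cost
    {𝒳 : Type*} [MetricSpace 𝒳] [MeasurableSpace 𝒳]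
    {H : Type*} [NormedAddCommGroup H] [InnerProductSpace ℝ H] [CompleteSpace H]
    [RKHS ℝ H 𝒳 ℝ]
    (hκ : Measurable (Function.uncurry (scalarKernel (𝒳 := 𝒳) H)))
    (c : H) (B : ℝ) (hB : ‖c‖ ≤ B)
    (lam : ℝ) (hlam : 1 ≤ lam)
    -- i.i.d. arrivals, predictable decisions to invoke the LLM, and sub-Gaussian noise
    {Ω : Type*} {mΩ : MeasurableSpace Ω} (μ : Measure Ω) [IsProbabilityMeasure μ]
    (ν : Measure 𝒳) [IsProbabilityMeasure ν]
    (ℱ : Filtration ℕ mΩ) (x : ℕ → Ω → 𝒳) (D : ℕ → Set Ω) (η : ℕ → Ω → ℝ)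
    (hx_indep : iIndepFun x μ) (hx_law : ∀ s, μ.map (x s) = ν)
    (hx : ∀ s, Measurable[ℱ s] (x s)) (hD : ∀ s, MeasurableSet[ℱ s] (D s))
    (hη : ∀ s, Measurable[ℱ (s + 1)] (η s))
    (R : ℝ) (hR : 0 ≤ R) (hsub : IsCondSubGaussian μ ℱ η R)
    -- an `ε`-net `S` of the effective region `A`, with at most `m_eff` centres, and its cells
    (ε : ℝ≥0) (A : Set 𝒳) (S : Finset 𝒳) (m_eff : ℕ)
    (hS : Metric.IsCover ε A (S : Set 𝒳)) (hm : S.card ≤ m_eff)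
    (V : 𝒳 → 𝒳) (hV : IsVoronoiAssignment S V)
    (δ : ℝ) (hδ0 : 0 < δ) (hδ1 : δ < 1) (T : ℕ) (hT : 1 ≤ T) :
    ∃ E : Set Ω, MeasurableSet E ∧ 1 - δ ≤ μ.real E ∧ ∀ ω ∈ E,
      (∀ t ∈ Finset.Icc 1 T,
        ∑ u ∈ S, |empWeight V x t ω u - cellWeight ν V u| ≤
          Real.sqrt (2 * m_eff * Real.log (2 * (T : ℝ) ^ 2 / δ) / t)) ∧
      (∀ t ∈ Finset.Icc 1 T, ∀ q : 𝒳,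
        |costEstimate (scalarKernel H) lam c x η D (t - 1) ω q - c q| ≤
          confRadius (scalarKernel H) lam B R δ x D (t - 1) ω q) ∧
      (∀ t ≤ T, ∀ q : 𝒳,
        costLCB (scalarKernel H) lam B R δ c x η D t ω q ≤ c q) := by

  have hx' : ∀ s, Measurable (x s) := fun s => (hx s).mono (ℱ.le s) le_rfl
  set bad₁ : Set Ω := {ω | ∃ t ∈ Finset.Icc 1 T,
    Real.sqrt (2 * m_eff * Real.log (2 * (T : ℝ) ^ 2 / δ) / t) <
      ∑ u ∈ S, |empWeight V x t ω u - cellWeight ν V u|} with hbad₁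
  -- No query point occurs here, and the rounds run from `0` to `T`, so one event serves both the
  -- estimate at `t - 1` and the lower bound at `t`.
  set bad₂ : Set Ω := {ω | ∃ t ≤ T, R ^ 2 * (2 * (infoGain (scalarKernel H) lam
    (obsInput x D t ω) + Real.log (2 / δ))) <
      ridgeEnergy (scalarKernel H) lam (obsInput x D t ω) (obsNoise η D t ω)} with hbad₂
  have h₁ : μ.real bad₁ ≤ δ / 2 :=
    measureReal_exists_lt_sum_abs_empWeight_sub_le hx_indep hx_law hx' hV hm hδ0 hδ1 hT
  have h₂ : μ.real bad₂ ≤ δ / 2 :=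
    ENNReal.toReal_le_of_le_ofReal (by positivity)
      (measure_exists_lt_ridgeEnergy_le (φ := fun p => RKHS.kerFun H p (1 : ℝ))
        scalarKernel_eq_inner hκ (by linarith) hx hD hη hR hsub hδ0 T)
  -- A measurable hull has the same measure, so measurability of the bad events need not be proved.
  have hmeas := measurableSet_toMeasurable μ (bad₁ ∪ bad₂)
  refine ⟨(toMeasurable μ (bad₁ ∪ bad₂))ᶜ, hmeas.compl, ?_, ?_⟩
  · rw [probReal_compl_eq_one_sub hmeas, Measure.real, measure_toMeasurable]
    have : μ.real (bad₁ ∪ bad₂) ≤ μ.real bad₁ + μ.real bad₂ := measureReal_union_le _ _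
    rw [Measure.real] at this
    linarith
  · intro ω hω
    have hω' : ω ∉ bad₁ ∪ bad₂ := fun h => hω (subset_toMeasurable _ _ h)
    have hω₁ : ω ∉ bad₁ := fun h => hω' (Or.inl h)
    have hω₂ : ω ∉ bad₂ := fun h => hω' (Or.inr h)
    have hconf : ∀ t ≤ T, ∀ q : 𝒳, |costEstimate (scalarKernel H) lam c x η D t ω q - c q| ≤
        confRadius (scalarKernel H) lam B R δ x D t ω q := fun t ht q =>
      abs_costEstimate_sub_le_confRadius c hB hlam hR
        (not_lt.1 fun h => hω₂ ⟨t, ht, h⟩) q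
    refine ⟨fun t ht => not_lt.1 fun h => hω₁ ⟨t, ht, h⟩, fun t ht q => ?_, fun t ht q => ?_⟩
    · exact hconf _ ((Nat.sub_le t 1).trans (Finset.mem_Icc.1 ht).2) q
    · have := (abs_le.1 (hconf t ht q)).2
      rw [costLCB]
      linarith
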